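/- Let $\boldsymbol p_1,\boldsymbol p_2,\boldsymbol p_3\in\mathbb R^3$ be affinely independent, let $T$ be the closed triangle with these nodes (indices are cyclic modulo $3$), and let $\boldsymbol q,\boldsymbol r_0\in\mathbb R^3$. Assume that $\boldsymbol r_0\notin T$ and that $\boldsymbol r_0$ lies on none of the three lines containing the sides of $T$. Put $\boldsymbol R=\boldsymbol r-\boldsymbol r_0$, $R=|\boldsymbol R|$ and $f(\boldsymbol r)=\boldsymbol q\cdot\boldsymbol R\,R^{-3}$. **Notation.** Let $\boldsymbol s_i=\boldsymbol p_{i-1}-\boldsymbol p_{i+1}$, $s_i=|\boldsymbol s_i|$, $\hat{\boldsymbol s}_i=\boldsymbol s_i/s_i$; $\hat{\boldsymbol w}=(\hat{\boldsymbol s}_1\times\hat{\boldsymbol s}_2)/|\hat{\boldsymbol s}_1\times\hat{\boldsymbol s}_2|$, $\hat{\boldsymbol u}=\hat{\boldsymbol s}_3$, $\hat{\boldsymbol v}=\hat{\boldsymbol w}\times\hat{\boldsymbol u}$, $\hat{\boldsymbol m}_i=\hat{\boldsymbol s}_i\times\hat{\boldsymbol w}$; $u_3=-\boldsymbol s_2\cdot\hat{\boldsymbol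 u}$, $v_3=-\boldsymbol s_2\cdot\hat{\boldsymbol v}$. The unit normal of $T$ is $\hat{\boldsymbol n}=\hat{\boldsymbol w}$. Write $\boldsymbol r_0=\boldsymbol\rho-w_0\hat{\boldsymbol w}$ with $\boldsymbol\rho=\boldsymbol p_1+u_0\hat{\boldsymbol u}+v_0\hat{\boldsymbol v}$, and for $\boldsymbol r\in T$ let $u_a=(\boldsymbol r-\boldsymbol\rho)\cdot\hat{\boldsymbol u}$, $v_a=(\boldsymbol r-\boldsymbol\rho)\cdot\hat{\boldsymbol v}$. For $i=1,2,3$ let $$t_i^0=(\boldsymbol p_{i+1}-\boldsymbol\rho)\cdot\hat{\boldsymbol m}_i,\quad \boldsymbol t_i^0=t_i^0\hat{\boldsymbol m}_i,\quad s_i^-=(\boldsymbol p_{i+1}-\boldsymbol\rho)\cdot\hat{\boldsymbol s}_i,\quad s_i^+=(\boldsymbol p_{i-1}-\boldsymbol\rho)\cdot\hat{\boldsymbol s}_i,$$ $$R_i^0=\sqrt{(t_i^0)^2+w_0^2},\qquad R_i^\pm=\sqrt{(s_i^\pm)^2+(t_i^0)^2+w_0^2},$$ $$f_{2i}=\ln\frac{R_i^++s_i^+}{R_i^-+s_i^-},\qquad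 R_i^s=\frac1{(R_i^0)^2}\Big(\frac{s_i^+}{R_i^+}-\frac{s_i^-}{R_i^-}\Big),\qquad R_i^d=\frac1{R_i^-}-\frac1{R_i^+},$$ $$\beta=\sum_{i=1}^3\Big(\arctan\frac{t_i^0s_i^+}{(R_i^0)^2+|w_0|R_i^+}-\arctan\frac{t_i^0s_i^-}{(R_i^0)^2+|w_0|R_i^-}\Big),$$ and let $\operatorname{sgn}$ be the sign function, with $\operatorname{sgn}(0)=0$. Define, by integration with respect to surface area, $$I_0=\int_T\hat{\boldsymbol n}\cdot\nabla f\,dT,\qquad \begin{Bmatrix}I_u^a\\ I_v^a\end{Bmatrix}=\int_T\begin{Bmatrix}u_a\\ v_a\end{Bmatrix}\hat{\boldsymbol n}\cdot\nabla f\,dT .$$ **Statement.** These integrals converge absolutely, and $$\begin{Bmatrix}I_u^a\\ I_v^a\end{Bmatrix}=\boldsymbol q\cdot\Bigg[w_0\sum_{i=1}^3\hat{\boldsymbol m}_i\begin{Bmatrix}\hat{\boldsymbol u}\\ \hat{\boldsymbol v}\end{Bmatrix}\cdot\big(\hat{\boldsymbol s}_iR_i^d+\boldsymbol t_i^0R_i^s\big)-\begin{Bmatrix}\hat{\boldsymbol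 u}\\ \hat{\boldsymbol v}\end{Bmatrix}\operatorname{sgn}(w_0)\,\beta+\hat{\boldsymbol w}\Big(\begin{Bmatrix}\hat{\boldsymbol u}\\ \hat{\boldsymbol v}\end{Bmatrix}\cdot\sum_{i=1}^3\hat{\boldsymbol m}_i\big(R_i^sw_0^2-f_{2i}\big)\Big)\Bigg],$$ where the upper, respectively lower, entries of the braces are taken throughout; moreover $$I_0=\boldsymbol q\cdot\sum_{i=1}^3R_i^s\big(w_0\hat{\boldsymbol m}_i-t_i^0\hat{\boldsymbol w}\big).$$ Consequently, for the linear basis functions, that is, for affine $\varphi_i:\mathbb R^3\to\mathbb R$ with $\varphi_i(\boldsymbol p_j)=\delta_{ij}$ $(i,j=1,2,3)$, the integrals defining the surface element source vector $\boldsymbol b^s=\frac1{4\pi}\int_T\boldsymbol\varphi\,\langle\nabla f,\hat{\boldsymbol n}\rangle\,dT$, $\boldsymbol\varphi=[\varphi_1,\varphi_2,\varphi_3]^T$, converge absolutely, and $$4\pi\,\boldsymbol b^s=I_0\begin{bmatrix}1&-s_3^{-1}&(u_3s_3^{-1}-1)v_3^{-1}\\0&s_3^{-1}&-u_3s_3^{-1}v_3^{-1}\\0&0&v_3^{-1}\end{bmatrix}\begin{bmatrix}1\\u_0\\v_0\end{bmatrix}+\begin{bmatrix}-s_3^{-1}&(u_3s_3^{-1}-1)v_3^{-1}\\s_3^{-1}&-u_3s_3^{-1}v_3^{-1}\\0&v_3^{-1}\end{bmatrix}\begin{bmatrix}I_u^a\\I_v^a\end{bmatrix}.$$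 -/

import Mathlib

open MeasureTheory
open scoped RealInnerProductSpace Gradient Matrix

noncomputable section

namespace SurfaceElement

/-- Physical space `ℝ³` with the Euclidean norm. -/
abbrev E3 : Type := EuclideanSpace ℝ (Fin 3)

/-- The vector product of `ℝ³`. -/
def cross (a b : E3) : E3 := WithLp.toLp 2 (a.ofLp ⨯₃ b.ofLp)

/-- `a / |a|`. -/
def unit (a : E3) : E3 := ‖a‖⁻¹ • a

/-! A triangle is given by its nodes `p : Fin 3 → E3`. The index `0, 1, 2` stands for `1, 2, 3`,
and `i - 1`, `i + 1` are taken cyclically (modulo 3), as they are in `Fin 3`. -/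

/-- The closed triangle `T` with nodes `p₁, p₂, p₃`. -/
def triangle (p : Fin 3 → E3) : Set E3 := convexHull ℝ (Set.range p)

/-- `s_i = p_{i-1} - p_{i+1}`, the side of the triangle opposite to `p_i`. -/
def side (p : Fin 3 → E3) (i : Fin 3) : E3 := p (i - 1) - p (i + 1)

/-- The length `s_i = |s_i|`. -/
def sideLen (p : Fin 3 → E3) (i : Fin 3) : ℝ := ‖side p i‖

/-- `ŝ_i`. -/
def sHat (p : Fin 3 → E3) (i : Fin 3) : E3 := unit (side p i)

/-- The unit normal `ŵ` of the triangle, in the direction of `ŝ₁ × ŝ₂`. -/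
def wHat (p : Fin 3 → E3) : E3 := unit (cross (sHat p 0) (sHat p 1))

/-- `û = ŝ₃`. -/
def uHat (p : Fin 3 → E3) : E3 := sHat p 2

/-- `v̂ = ŵ × û`. -/
def vHat (p : Fin 3 → E3) : E3 := cross (wHat p) (uHat p)

/-- `m̂_i = ŝ_i × ŵ`, the outward unit normal to the `i`-th side in the plane of the triangle. -/
def mHat (p : Fin 3 → E3) (i : Fin 3) : E3 := cross (sHat p i) (wHat p)

/-- `u₃ = - s₂ · û`: the local frame has its origin in `p₁`, and there `p₃ = [u₃, v₃]`. -/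
def u3 (p : Fin 3 → E3) : ℝ := -⟪side p 1, uHat p⟫

/-- `v₃ = - s₂ · v̂`. -/
def v3 (p : Fin 3 → E3) : ℝ := -⟪side p 1, vHat p⟫

/-! The point `r₀ = ρ - w₀ ŵ` is the position of the dipole, and `ρ = [u₀, v₀, 0]`. -/

def u0 (p : Fin 3 → E3) (r₀ : E3) : ℝ := ⟪r₀ - p 0, uHat p⟫

def v0 (p : Fin 3 → E3) (r₀ : E3) : ℝ := ⟪r₀ - p 0, vHat p⟫

def w0 (p : Fin 3 → E3) (r₀ : E3) : ℝ := -⟪r₀ - p 0, wHat p⟫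

/-- `ρ`, the projection of `r₀` onto the plane of the triangle. -/
def rho (p : Fin 3 → E3) (r₀ : E3) : E3 := p 0 + u0 p r₀ • uHat p + v0 p r₀ • vHat p

/-- The pair `{û, v̂}`. -/
def axis (p : Fin 3 → E3) : Fin 2 → E3 := ![uHat p, vHat p]

/-- The pair of coordinates `{u_a, v_a}` of `r` in the local frame translated to the origin `ρ`. -/
def coordA (p : Fin 3 → E3) (r₀ : E3) (k : Fin 2) (r : E3) : ℝ := ⟪axis p k, r - rho p r₀⟫

/-! The `i`-th side is parametrised from `p_{i+1}` to `p_{i-1}` as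
`ρ + t_i⁰ m̂_i + s ŝ_i`, `s ∈ [s_i⁻, s_i⁺]`. -/

/-- `t_i⁰`, the signed distance (along `m̂_i`) from `ρ` to the line of the `i`-th side. -/
def t0 (p : Fin 3 → E3) (r₀ : E3) (i : Fin 3) : ℝ := ⟪p (i + 1) - rho p r₀, mHat p i⟫

/-- `s_i⁻`, the parameter of `p_{i+1}`. -/
def sMinus (p : Fin 3 → E3) (r₀ : E3) (i : Fin 3) : ℝ := ⟪p (i + 1) - rho p r₀, sHat p i⟫

/-- `s_i⁺`, the parameter of `p_{i-1}`. -/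
def sPlus (p : Fin 3 → E3) (r₀ : E3) (i : Fin 3) : ℝ := ⟪p (i - 1) - rho p r₀, sHat p i⟫

/-- `R_i⁰`. -/
def R0 (p : Fin 3 → E3) (r₀ : E3) (i : Fin 3) : ℝ :=
  Real.sqrt (t0 p r₀ i ^ 2 + w0 p r₀ ^ 2)

/-- `R_i⁻`. -/
def RMinus (p : Fin 3 → E3) (r₀ : E3) (i : Fin 3) : ℝ :=
  Real.sqrt (sMinus p r₀ i ^ 2 + t0 p r₀ i ^ 2 + w0 p r₀ ^ 2)

/-- `R_i⁺`. -/
def RPlus (p : Fin 3 → E3) (r₀ : E3) (i : Fin 3) : ℝ :=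
  Real.sqrt (sPlus p r₀ i ^ 2 + t0 p r₀ i ^ 2 + w0 p r₀ ^ 2)

/-- `f_{2i}`. -/
def f2 (p : Fin 3 → E3) (r₀ : E3) (i : Fin 3) : ℝ :=
  Real.log ((RPlus p r₀ i + sPlus p r₀ i) / (RMinus p r₀ i + sMinus p r₀ i))

/-- `R_i^s`. -/
def Rs (p : Fin 3 → E3) (r₀ : E3) (i : Fin 3) : ℝ :=
  1 / R0 p r₀ i ^ 2 * (sPlus p r₀ i / RPlus p r₀ i - sMinus p r₀ i / RMinus p r₀ i)

/-- `R_i^d`. -/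
def Rd (p : Fin 3 → E3) (r₀ : E3) (i : Fin 3) : ℝ := (RMinus p r₀ i)⁻¹ - (RPlus p r₀ i)⁻¹

/-- `β = β₁ + β₂ + β₃`. -/
def beta (p : Fin 3 → E3) (r₀ : E3) : ℝ :=
  ∑ i, (Real.arctan (t0 p r₀ i * sPlus p r₀ i / (R0 p r₀ i ^ 2 + |w0 p r₀| * RPlus p r₀ i))
    - Real.arctan (t0 p r₀ i * sMinus p r₀ i / (R0 p r₀ i ^ 2 + |w0 p r₀| * RMinus p r₀ i)))

/-- `f(r) = q · R / R³` with `R = r - r₀`. -/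
def dipole (q r₀ : E3) (r : E3) : ℝ := ⟪q, r - r₀⟫ / ‖r - r₀‖ ^ 3

/-- `n̂ · ∇f(r)`, where the unit normal `n̂` of the triangle is `ŵ`. -/
def normalFlux (p : Fin 3 → E3) (q r₀ : E3) (r : E3) : ℝ := ⟪wHat p, ∇ (dipole q r₀) r⟫

/-- `I₀ = ∫_T n̂ · ∇f`, an integral with respect to surface area. -/
def I0 (p : Fin 3 → E3) (q r₀ : E3) : ℝ :=
  ∫ r in triangle p, normalFlux p q r₀ r ∂μHE[2]

/-- The pair `{I_u^a, I_v^a} = ∫_T {u_a, v_a} n̂ · ∇f`. -/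
def Ia (p : Fin 3 → E3) (q r₀ : E3) (k : Fin 2) : ℝ :=
  ∫ r in triangle p, coordA p r₀ k r * normalFlux p q r₀ r ∂μHE[2]

/-- The surface element source vector `b^s = (4π)⁻¹ ∫_T φ ⟨∇f, n̂⟩` of the functions `φ`. -/
def bs (p : Fin 3 → E3) (q r₀ : E3) (φ : Fin 3 → E3 → ℝ) (i : Fin 3) : ℝ :=
  1 / (4 * Real.pi) * ∫ r in triangle p, φ i r * normalFlux p q r₀ r ∂μHE[2]

/-- The matrix of the linear basis functions in the local frame, `φ(u, v) = Φ [1, u, v]ᵀ`. -/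
def basisMatrix (p : Fin 3 → E3) : Matrix (Fin 3) (Fin 3) ℝ :=
  !![1, -(sideLen p 2)⁻¹, (u3 p * (sideLen p 2)⁻¹ - 1) * (v3 p)⁻¹;
     0, (sideLen p 2)⁻¹, -(u3 p * (sideLen p 2)⁻¹ * (v3 p)⁻¹);
     0, 0, (v3 p)⁻¹]

/-- The last two columns of `basisMatrix`. -/
def basisMatrixLin (p : Fin 3 → E3) : Matrix (Fin 3) (Fin 2) ℝ :=
  !![-(sideLen p 2)⁻¹, (u3 p * (sideLen p 2)⁻¹ - 1) * (v3 p)⁻¹;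
     (sideLen p 2)⁻¹, -(u3 p * (sideLen p 2)⁻¹ * (v3 p)⁻¹);
     0, (v3 p)⁻¹]

end SurfaceElement

end

/-!
Write `R = |r - r₀|`. By the divergence theorem in the plane of the triangle, the integral over `T`
of a tangential derivative `∂_d g` is the sum over the sides of `d · m̂_i` times the line integral
of `g`, and on the line of the `i`-th side `R² = s² + (R_i⁰)²`, so that the line integrals of radial
functions are elementary. The functions `R⁻¹`, `R⁻³` and `(a · (r - r₀)) R⁻³` yield in this way
`f_{2i}`, `R_i^s` and `R_i^d`. The remaining integral, the solid angle `w₀ ∫_T R⁻³`, comes from the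
plane vector field `(r - ρ) / (R (R + |w₀|))`, which has divergence `|w₀| R⁻³` and, as `r₀ ∉ T`, is
smooth on `T` even where `r = ρ`.
-/

noncomputable section

namespace SurfaceElement

/-! ### The vector product -/

lemma inner_eq_dotProduct (a b : E3) : ⟪a, b⟫ = a.ofLp ⬝ᵥ b.ofLp := by
  rw [EuclideanSpace.inner_eq_star_dotProduct, star_trivial, dotProduct_comm]

lemma cross_smul_left (c : ℝ) (a b : E3) : cross (c • a) b = c • cross a b := by
  simp only [cross, WithLp.ofLp_smul, map_smul, LinearMap.smul_apply, WithLp.toLp_smul]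

lemma cross_smul_right (c : ℝ) (a b : E3) : cross a (c • b) = c • cross a b := by
  simp only [cross, WithLp.ofLp_smul, map_smul, WithLp.toLp_smul]

lemma neg_cross (a b : E3) : -cross a b = cross b a := by
  rw [cross, ← WithLp.toLp_neg, cross_anticomm, ← cross]

lemma inner_self_cross (a b : E3) : ⟪a, cross a b⟫ = 0 := by
  rw [inner_eq_dotProduct]
  exact dot_self_cross _ _

lemma inner_cross_self (a b : E3) : ⟪b, cross a b⟫ = 0 := by
  rw [inner_eq_dotProduct]
  exact dot_cross_self _ _

lemma inner_cross_permutation (a b c : E3) : ⟪a, cross b c⟫ = ⟪b, cross c a⟫ := by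
  simp only [inner_eq_dotProduct]
  exact triple_product_permutation _ _ _

lemma inner_cross_cross (a b c d : E3) :
    ⟪cross a b, cross c d⟫ = ⟪a, c⟫ * ⟪b, d⟫ - ⟪a, d⟫ * ⟪b, c⟫ := by
  simp only [inner_eq_dotProduct]
  exact cross_dot_cross _ _ _ _

lemma norm_cross_of_inner_eq_zero {a b : E3} (h : ⟪a, b⟫ = 0) : ‖cross a b‖ = ‖a‖ * ‖b‖ := by
  rw [← sq_eq_sq₀ (norm_nonneg _) (by positivity), ← real_inner_self_eq_norm_sq,
    inner_cross_cross, h, real_inner_self_eq_norm_sq, real_inner_self_eq_norm_sq]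
  ring

lemma norm_cross_sq_smul (a b d : E3) :
    ‖cross a b‖ ^ 2 • d = ⟪cross d b, cross a b⟫ • a + ⟪cross a d, cross a b⟫ • b
      + ⟪d, cross a b⟫ • cross a b := by
  rw [← real_inner_self_eq_norm_sq]
  simp only [inner_eq_dotProduct]
  ext i
  fin_cases i <;> simp [cross, cross_apply, dotProduct, Fin.sum_univ_three] <;> ring

lemma eq_inner_smul_add_of_orthonormal {a w : E3} (ha : ‖a‖ = 1) (hw : ‖w‖ = 1) (h : ⟪a, w⟫ = 0)
    (x : E3) : x = ⟪a, x⟫ • a + ⟪cross a w, x⟫ • cross a w + ⟪w, x⟫ • w := by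
  have hcramer := norm_cross_sq_smul a w x
  rw [norm_cross_of_inner_eq_zero h, ha, hw, inner_cross_cross, inner_cross_cross,
    real_inner_self_eq_norm_sq, real_inner_self_eq_norm_sq, ha, hw, real_inner_comm a w, h,
    real_inner_comm a x, real_inner_comm w x, real_inner_comm (cross a w) x] at hcramer
  linear_combination (norm := module) hcramer

/-! ### The frame of the triangle -/

section Frame

variable {p : Fin 3 → E3} {r₀ : E3}

/-- The vector area of the parallelogram spanned by the triangle: a normal vector of the triangle
whose length is twice its area. -/
def areaVec (p : Fin 3 → E3) : E3 := cross (p 1 - p 0) (p 2 - p 0)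

lemma cross_side_side_add_one (p : Fin 3 → E3) (i : Fin 3) :
    cross (side p i) (side p (i + 1)) = areaVec p := by
  have hneg : (-1 : Fin 3) = 2 := rfl
  ext j
  fin_cases i <;> fin_cases j <;> simp [hneg, side, areaVec, cross, cross_apply] <;> ring

lemma areaVec_ne_zero (hp : AffineIndependent ℝ p) : areaVec p ≠ 0 := by
  have hsides := ((affineIndependent_iff_linearIndependent_vsub ℝ p 0).1 hp).comp
    (fun i : Fin 2 => ⟨i.succ, i.succ_ne_zero⟩)
    (fun i j hij => Fin.succ_injective _ (congrArg Subtype.val hij))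
  have hcoord : LinearIndependent ℝ ![(p 1 - p 0).ofLp, (p 2 - p 0).ofLp] := by
    convert! hsides.map' (WithLp.linearEquiv 2 ℝ (Fin 3 → ℝ)).toLinearMap (LinearEquiv.ker _)
    ext i : 1
    fin_cases i <;> rfl
  exact (WithLp.toLp_eq_zero 2).not.2 (crossProduct_ne_zero_iff_linearIndependent.2 hcoord)

lemma side_ne_zero (hp : AffineIndependent ℝ p) (i : Fin 3) : side p i ≠ 0 :=
  sub_ne_zero.2 (hp.injective.ne (by fin_cases i <;> decide))

lemma sideLen_pos (hp : AffineIndependent ℝ p) (i : Fin 3) : 0 < sideLen p i :=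
  norm_pos_iff.2 (side_ne_zero hp i)

lemma sideLen_smul_sHat (p : Fin 3 → E3) (i : Fin 3) : sideLen p i • sHat p i = side p i :=
  NormedSpace.norm_smul_normalize _

lemma norm_sHat (hp : AffineIndependent ℝ p) (i : Fin 3) : ‖sHat p i‖ = 1 :=
  NormedSpace.norm_normalize (side_ne_zero hp i)

lemma wHat_eq_unit_areaVec (hp : AffineIndependent ℝ p) : wHat p = unit (areaVec p) := by
  have hcross : cross (sHat p 0) (sHat p 1) = (‖side p 0‖⁻¹ * ‖side p 1‖⁻¹) • areaVec p := by
    rw [sHat, sHat, unit, unit, cross_smul_left, cross_smul_right, smul_smul,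
      ← cross_side_side_add_one p 0, zero_add]
  have := sideLen_pos hp 0
  have := sideLen_pos hp 1
  rw [wHat, hcross]
  exact NormedSpace.normalize_smul_of_pos (by unfold sideLen at *; positivity) _

lemma norm_wHat (hp : AffineIndependent ℝ p) : ‖wHat p‖ = 1 := by
  rw [wHat_eq_unit_areaVec hp]
  exact NormedSpace.norm_normalize (areaVec_ne_zero hp)

lemma norm_areaVec_smul_wHat (hp : AffineIndependent ℝ p) : ‖areaVec p‖ • wHat p = areaVec p := by
  rw [wHat_eq_unit_areaVec hp]
  exact NormedSpace.norm_smul_normalize _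

lemma inner_side_wHat (hp : AffineIndependent ℝ p) (i : Fin 3) : ⟪side p i, wHat p⟫ = 0 := by
  have h : ⟪side p i, areaVec p⟫ = 0 := by
    rw [← cross_side_side_add_one p i, inner_self_cross]
  rw [wHat_eq_unit_areaVec hp, unit, inner_smul_right, h, mul_zero]

lemma inner_sHat_wHat (hp : AffineIndependent ℝ p) (i : Fin 3) : ⟪sHat p i, wHat p⟫ = 0 := by
  rw [sHat, unit, inner_smul_left, inner_side_wHat hp, mul_zero]

lemma inner_node_wHat (hp : AffineIndependent ℝ p) (i : Fin 3) :
    ⟪p i, wHat p⟫ = ⟪p 0, wHat p⟫ := by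
  have h1 : ⟪p 0 - p 2, wHat p⟫ = 0 := inner_side_wHat hp 1
  have h2 : ⟪p 1 - p 0, wHat p⟫ = 0 := inner_side_wHat hp 2
  rw [inner_sub_left] at h1 h2
  fin_cases i <;> dsimp only [Fin.reduceFinMk] <;> linarith

lemma norm_uHat (hp : AffineIndependent ℝ p) : ‖uHat p‖ = 1 := norm_sHat hp 2

lemma inner_uHat_wHat (hp : AffineIndependent ℝ p) : ⟪uHat p, wHat p⟫ = 0 := inner_sHat_wHat hp 2

lemma norm_vHat (hp : AffineIndependent ℝ p) : ‖vHat p‖ = 1 := by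
  rw [vHat, norm_cross_of_inner_eq_zero (by rw [real_inner_comm, inner_uHat_wHat hp]),
    norm_wHat hp, norm_uHat hp, one_mul]

lemma inner_vHat_wHat (p : Fin 3 → E3) : ⟪vHat p, wHat p⟫ = 0 := by
  rw [real_inner_comm]
  exact inner_self_cross _ _

lemma norm_axis (hp : AffineIndependent ℝ p) (k : Fin 2) : ‖axis p k‖ = 1 := by
  fin_cases k
  exacts [norm_uHat hp, norm_vHat hp]

lemma inner_axis_wHat (hp : AffineIndependent ℝ p) (k : Fin 2) : ⟪axis p k, wHat p⟫ = 0 := by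
  fin_cases k
  exacts [inner_uHat_wHat hp, inner_vHat_wHat p]

lemma eq_frame_expansion (hp : AffineIndependent ℝ p) (x : E3) :
    x = ⟪uHat p, x⟫ • uHat p + ⟪vHat p, x⟫ • vHat p + ⟪wHat p, x⟫ • wHat p := by
  have h := eq_inner_smul_add_of_orthonormal (norm_uHat hp) (norm_wHat hp) (inner_uHat_wHat hp) x
  rwa [← neg_cross, ← vHat, inner_neg_left, neg_smul_neg] at h

lemma inner_eq_frame_expansion (hp : AffineIndependent ℝ p) (x y : E3) :
    ⟪x, y⟫ = ⟪uHat p, x⟫ * ⟪uHat p, y⟫ + ⟪vHat p, x⟫ * ⟪vHat p, y⟫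
      + ⟪wHat p, x⟫ * ⟪wHat p, y⟫ := by
  conv_lhs => rw [eq_frame_expansion hp x]
  simp only [inner_add_left, inner_smul_left, conj_trivial]

lemma sum_inner_axis_mul_inner_axis (hp : AffineIndependent ℝ p) (x y : E3) :
    ∑ k, ⟪axis p k, x⟫ * ⟪axis p k, y⟫ = ⟪x, y⟫ - ⟪wHat p, x⟫ * ⟪wHat p, y⟫ := by
  rw [inner_eq_frame_expansion hp, add_sub_cancel_right, Fin.sum_univ_two]
  rfl

lemma inner_mHat_wHat (p : Fin 3 → E3) (i : Fin 3) : ⟪mHat p i, wHat p⟫ = 0 := by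
  rw [real_inner_comm]
  exact inner_cross_self _ _

lemma inner_mHat_sHat (p : Fin 3 → E3) (i : Fin 3) : ⟪mHat p i, sHat p i⟫ = 0 := by
  rw [real_inner_comm]
  exact inner_self_cross _ _

lemma norm_mHat (hp : AffineIndependent ℝ p) (i : Fin 3) : ‖mHat p i‖ = 1 := by
  rw [mHat, norm_cross_of_inner_eq_zero (inner_sHat_wHat hp i), norm_sHat hp, norm_wHat hp, one_mul]

lemma eq_mHat_add_sHat_of_inner_wHat_eq_zero (hp : AffineIndependent ℝ p) (i : Fin 3) {x : E3}
    (hx : ⟪x, wHat p⟫ = 0) : x = ⟪x, mHat p i⟫ • mHat p i + ⟪x, sHat p i⟫ • sHat p i := by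
  have h :=
    eq_inner_smul_add_of_orthonormal (norm_sHat hp i) (norm_wHat hp) (inner_sHat_wHat hp i) x
  rwa [← mHat, real_inner_comm x (wHat p), hx, zero_smul, add_zero, add_comm,
    real_inner_comm x (mHat p i), real_inner_comm x (sHat p i)] at h

lemma sideLen_mul_inner_mHat (p : Fin 3 → E3) (i : Fin 3) (d : E3) :
    sideLen p i * ⟪d, mHat p i⟫ = ⟪cross d (side p i), wHat p⟫ := by
  rw [mHat, ← inner_smul_right, ← cross_smul_left, sideLen_smul_sHat, inner_cross_permutation,
    inner_cross_permutation, real_inner_comm]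

lemma rho_sub (hp : AffineIndependent ℝ p) (r₀ : E3) : rho p r₀ - r₀ = w0 p r₀ • wHat p := by
  have h := eq_frame_expansion hp (r₀ - p 0)
  rw [rho, u0, v0, w0, real_inner_comm (uHat p), real_inner_comm (vHat p), real_inner_comm (wHat p)]
  linear_combination (norm := module) (-1 : ℝ) • h

lemma inner_sub_rho_wHat (hp : AffineIndependent ℝ p) (r₀ : E3) (i : Fin 3) :
    ⟪p i - rho p r₀, wHat p⟫ = 0 := by
  rw [rho, add_assoc, ← sub_sub, inner_sub_left, inner_sub_left, inner_node_wHat hp,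
    inner_add_left, inner_smul_left, inner_smul_left, inner_uHat_wHat hp, inner_vHat_wHat]
  ring

lemma node_sub_rho (hp : AffineIndependent ℝ p) (r₀ : E3) (i : Fin 3) :
    p (i + 1) - rho p r₀ = t0 p r₀ i • mHat p i + sMinus p r₀ i • sHat p i :=
  eq_mHat_add_sHat_of_inner_wHat_eq_zero hp i (inner_sub_rho_wHat hp r₀ _)

lemma sPlus_eq_add_sideLen (hp : AffineIndependent ℝ p) (r₀ : E3) (i : Fin 3) :
    sPlus p r₀ i = sMinus p r₀ i + sideLen p i := by
  rw [sPlus, sMinus, ← sub_eq_iff_eq_add', ← inner_sub_left, sub_sub_sub_cancel_right,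
    ← side, ← sideLen_smul_sHat, real_inner_smul_left, real_inner_self_eq_norm_sq, norm_sHat hp,
    one_pow, mul_one]

lemma R0_sq (p : Fin 3 → E3) (r₀ : E3) (i : Fin 3) :
    R0 p r₀ i ^ 2 = t0 p r₀ i ^ 2 + w0 p r₀ ^ 2 := Real.sq_sqrt (by positivity)

lemma RPlus_eq_sqrt (p : Fin 3 → E3) (r₀ : E3) (i : Fin 3) :
    RPlus p r₀ i = √(sPlus p r₀ i ^ 2 + R0 p r₀ i ^ 2) := by rw [RPlus, R0_sq, add_assoc]

lemma RMinus_eq_sqrt (p : Fin 3 → E3) (r₀ : E3) (i : Fin 3) :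
    RMinus p r₀ i = √(sMinus p r₀ i ^ 2 + R0 p r₀ i ^ 2) := by rw [RMinus, R0_sq, add_assoc]

lemma R0_pos (hp : AffineIndependent ℝ p) {i : Fin 3}
    (hline : r₀ ∉ line[ℝ, p (i - 1), p (i + 1)]) : 0 < R0 p r₀ i := by
  rw [R0, Real.sqrt_pos]
  refine (by positivity : (0 : ℝ) ≤ _).lt_of_ne' fun hzero => hline ?_
  obtain ⟨ht, hw⟩ : t0 p r₀ i = 0 ∧ w0 p r₀ = 0 := by
    constructor <;> nlinarith [sq_nonneg (t0 p r₀ i), sq_nonneg (w0 p r₀)]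
  have hrho : rho p r₀ = r₀ := by rw [← sub_eq_zero, rho_sub hp, hw, zero_smul]
  have hnode : p (i + 1) - r₀ = (sMinus p r₀ i * (sideLen p i)⁻¹) • side p i := by
    rw [← sideLen_smul_sHat, smul_smul, inv_mul_cancel_right₀ (sideLen_pos hp i).ne', ← hrho,
      node_sub_rho hp, hrho, ht, zero_smul, zero_add]
  have hr₀ : r₀ = AffineMap.lineMap (p (i + 1)) (p (i - 1))
      (-(sMinus p r₀ i * (sideLen p i)⁻¹)) := by
    rw [AffineMap.lineMap_apply, vsub_eq_sub, ← side, neg_smul, ← hnode, vadd_eq_add]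
    abel
  rw [Set.pair_comm, hr₀]
  exact AffineMap.lineMap_mem_affineSpan_pair _ _ _

lemma sum_side (p : Fin 3 → E3) : ∑ i, side p i = 0 := by
  simp only [side, Finset.sum_sub_distrib]
  rw [sub_eq_zero]
  exact (Equiv.sum_comp (Equiv.subRight (1 : Fin 3)) p).trans
    (Equiv.sum_comp (Equiv.addRight (1 : Fin 3)) p).symm

lemma sum_sideLen_mul_inner_mHat (p : Fin 3 → E3) (d : E3) :
    ∑ i, sideLen p i * ⟪d, mHat p i⟫ = 0 := by
  have hside (i : Fin 3) :
      sideLen p i * ⟪d, mHat p i⟫ = ⟪side p i, cross (wHat p) d⟫ := by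
    rw [sideLen_mul_inner_mHat, real_inner_comm, inner_cross_permutation, inner_cross_permutation]
  simp only [hside]
  rw [← sum_inner, sum_side, inner_zero_left]

lemma norm_areaVec_smul_of_inner_wHat_eq_zero (hp : AffineIndependent ℝ p) {d : E3}
    (hd : ⟪d, wHat p⟫ = 0) :
    ‖areaVec p‖ • d = (sideLen p 2 * ⟪d, mHat p 2⟫) • side p 1
      - (sideLen p 1 * ⟪d, mHat p 1⟫) • side p 2 := by
  have hcramer := norm_cross_sq_smul (side p 1) (side p 2) d
  rw [show cross (side p 1) (side p 2) = areaVec p from cross_side_side_add_one p 1,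
    ← neg_cross d (side p 1)] at hcramer
  have harea (x : E3) : ⟪x, areaVec p⟫ = ‖areaVec p‖ * ⟪x, wHat p⟫ := by
    rw [← inner_smul_right, norm_areaVec_smul_wHat hp]
  simp only [harea, hd, inner_neg_left, ← sideLen_mul_inner_mHat] at hcramer
  refine smul_right_injective _ (norm_ne_zero_iff.2 (areaVec_ne_zero hp)) ?_
  linear_combination (norm := module) hcramer

end Frame

/-! ### Integration over the triangle -/

section Integration

variable {F : Type*} [NormedAddCommGroup F] {p : Fin 3 → E3}

/-- The triangle with nodes `(0, 0)`, `(1, 0)`, `(0, 1)`, the parameter domain of `triMap`. -/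
def stdTriangle : Set (ℝ × ℝ) := {x | 0 ≤ x.1 ∧ 0 ≤ x.2 ∧ x.1 + x.2 ≤ 1}

/-- The affine parametrisation of the triangle with nodes `p` by `stdTriangle`. -/
def triMap (p : Fin 3 → E3) (x : ℝ × ℝ) : E3 := p 0 + (x.1 • (p 1 - p 0) + x.2 • (p 2 - p 0))

lemma continuous_triMap (p : Fin 3 → E3) : Continuous (triMap p) := by
  unfold triMap
  fun_prop

lemma isCompact_stdTriangle : IsCompact stdTriangle := by
  refine (isCompact_Icc (a := (0 : ℝ × ℝ)) (b := 1)).of_isClosed_subset ?_ ?_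
  · exact ((isClosed_le continuous_const continuous_fst).inter
      ((isClosed_le continuous_const continuous_snd).inter
        (isClosed_le (continuous_fst.add continuous_snd) continuous_const)))
  · rintro ⟨a, b⟩ ⟨ha, hb, hab⟩
    dsimp only at ha hb hab
    exact ⟨⟨ha, hb⟩, ⟨show a ≤ 1 by linarith, show b ≤ 1 by linarith⟩⟩

lemma convexHull_range_eq_image_stdSimplex {ι V : Type*} [Fintype ι] [AddCommGroup V] [Module ℝ V]
    (v : ι → V) : convexHull ℝ (Set.range v) = Fintype.linearCombination ℝ v '' stdSimplex ℝ ι := by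
  classical
  rw [← convexHull_rangle_single_eq_stdSimplex, LinearMap.image_convexHull, ← Set.range_comp]
  congr 2
  ext i
  simp

lemma triangle_eq_image (p : Fin 3 → E3) : triangle p = triMap p '' stdTriangle := by
  rw [triangle, convexHull_range_eq_image_stdSimplex]
  ext x
  constructor
  · rintro ⟨w, ⟨hw, hsum⟩, rfl⟩
    rw [Fin.sum_univ_three] at hsum
    refine ⟨(w 1, w 2), ⟨hw 1, hw 2, show w 1 + w 2 ≤ 1 by linarith [hw 0]⟩, ?_⟩
    rw [triMap, Fintype.linearCombination_apply, Fin.sum_univ_three,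
      show w 0 = 1 - w 1 - w 2 by linarith]
    module
  · rintro ⟨⟨a, b⟩, ⟨ha, hb, hab⟩, rfl⟩
    dsimp only at ha hb hab
    refine ⟨![1 - a - b, a, b], ⟨?_, ?_⟩, ?_⟩
    · rw [Fin.forall_fin_succ, Fin.forall_fin_two]
      exact ⟨show 0 ≤ 1 - a - b by linarith, ha, hb⟩
    · rw [Fin.sum_univ_three]
      exact show 1 - a - b + a + b = 1 by ring
    · rw [triMap, Fintype.linearCombination_apply, Fin.sum_univ_three]
      simp only [Matrix.cons_val]
      module

lemma triMap_mem {x : ℝ × ℝ} (hx : x ∈ stdTriangle) : triMap p x ∈ triangle p := by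
  rw [triangle_eq_image]
  exact Set.mem_image_of_mem _ hx

lemma isCompact_triangle (p : Fin 3 → E3) : IsCompact (triangle p) := by
  rw [triangle_eq_image]
  exact isCompact_stdTriangle.image (continuous_triMap p)

lemma euclideanHausdorffMeasure_image_smul_add_smul (a b : E3) (B : Set (ℝ × ℝ)) :
    μHE[2] ((fun x : ℝ × ℝ => x.1 • a + x.2 • b) '' B)
      = ENNReal.ofReal ‖cross a b‖ * volume B := by
  let c : ℝ × ℝ ≃ᵐ EuclideanSpace ℝ (Fin 2) :=
    MeasurableEquiv.finTwoArrow.symm.trans (MeasurableEquiv.toLp 2 (Fin 2 → ℝ))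
  have hc : MeasurePreserving c volume volume :=
    (PiLp.volume_preserving_toLp (Fin 2)).comp (volume_preserving_finTwoArrow ℝ).symm
  let f : EuclideanSpace ℝ (Fin 2) →ₗ[ℝ] E3 :=
    Fintype.linearCombination ℝ ![a, b] ∘ₗ (WithLp.linearEquiv 2 ℝ (Fin 2 → ℝ)).toLinearMap
  have hf (y : EuclideanSpace ℝ (Fin 2)) : f y = y 0 • a + y 1 • b := by
    simp [f, Fintype.linearCombination_apply, Fin.sum_univ_two]
  have hdet : f.normDet = ‖cross a b‖ := by
    have hgram := f.normDet_sq_eq_det_gram (EuclideanSpace.basisFun (Fin 2) ℝ)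
    rw [← sq_eq_sq₀ f.normDet_nonneg (norm_nonneg _), ← real_inner_self_eq_norm_sq,
      inner_cross_cross]
    simpa [Matrix.det_fin_two, Matrix.gram_apply, hf] using hgram
  have himage : (fun x : ℝ × ℝ => x.1 • a + x.2 • b) '' B = f '' (c '' B) := by
    rw [Set.image_image]
    exact Set.image_congr fun x _ => (hf (c x)).symm
  have hvolume : volume (c '' B) = volume B := by
    rw [← hc.measure_preimage_equiv, c.preimage_image]
  rw [himage, ← hvolume, ← hdet, ← f.euclideanHausdorffMeasure_image_eq_normDet_mul_volume,
    finrank_euclideanSpace_fin]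

lemma euclideanHausdorffMeasure_triMap_image (p : Fin 3 → E3) (B : Set (ℝ × ℝ)) :
    μHE[2] (triMap p '' B) = ENNReal.ofReal ‖areaVec p‖ * volume B := by
  have himage : triMap p '' B
      = (p 0 + ·) '' ((fun x : ℝ × ℝ => x.1 • (p 1 - p 0) + x.2 • (p 2 - p 0)) '' B) := by
    rw [Set.image_image]
    rfl
  rw [himage, (isometry_add_left (p 0)).euclideanHausdorffMeasure_image,
    euclideanHausdorffMeasure_image_smul_add_smul, areaVec]

lemma restrict_triangle (p : Fin 3 → E3) :
    (μHE[2] : Measure E3).restrict (triangle p)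
      = ENNReal.ofReal ‖areaVec p‖ • (volume.restrict stdTriangle).map (triMap p) := by
  ext A hA
  rw [Measure.restrict_apply hA, Measure.smul_apply,
    Measure.map_apply (continuous_triMap p).measurable hA,
    Measure.restrict_apply ((continuous_triMap p).measurable hA), triangle_eq_image,
    ← Set.image_preimage_inter, euclideanHausdorffMeasure_triMap_image, smul_eq_mul]

lemma integrableOn_triangle {h : E3 → F} (hh : ContinuousOn h (triangle p)) :
    IntegrableOn h (triangle p) μHE[2] := by
  obtain ⟨C, hC⟩ := (isCompact_triangle p).exists_bound_of_continuousOn hh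
  have hmeas := (isCompact_triangle p).measurableSet
  refine IntegrableOn.of_bound (lt_top_iff_ne_top.2 ?_) (hh.aestronglyMeasurable hmeas) C
    (ae_restrict_of_forall_mem hmeas hC)
  rw [triangle_eq_image, euclideanHausdorffMeasure_triMap_image]
  exact ENNReal.mul_ne_top ENNReal.ofReal_ne_top isCompact_stdTriangle.measure_ne_top

variable [NormedSpace ℝ F]

lemma integral_triangle {h : E3 → F} (hh : ContinuousOn h (triangle p)) :
    ∫ r in triangle p, h r ∂μHE[2] = ‖areaVec p‖ • ∫ x in stdTriangle, h (triMap p x) := by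
  have hint := integrableOn_triangle hh
  rw [IntegrableOn, restrict_triangle] at hint
  obtain harea | harea := eq_or_ne (areaVec p) 0
  · simp [restrict_triangle, harea]
  · rw [restrict_triangle, integral_smul_measure, ENNReal.toReal_ofReal (norm_nonneg _),
      integral_map (continuous_triMap p).aemeasurable]
    exact ((integrable_smul_measure (by simpa using harea) ENNReal.ofReal_ne_top).1 hint).1

lemma integral_stdTriangle {G : ℝ × ℝ → F} (hG : ContinuousOn G stdTriangle) :
    ∫ x in stdTriangle, G x = ∫ a in (0 : ℝ)..1, ∫ b in (0 : ℝ)..(1 - a), G (a, b) := by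
  have hmeas := isCompact_stdTriangle.measurableSet
  have hint : Integrable (stdTriangle.indicator G) :=
    (hG.integrableOn_compact isCompact_stdTriangle).integrable_indicator hmeas
  have hslice (a b : ℝ) : stdTriangle.indicator G (a, b)
      = (Set.Icc 0 1).indicator
          (fun a => (Set.Icc 0 (1 - a)).indicator (fun b => G (a, b)) b) a := by
    have hmem : (a, b) ∈ stdTriangle ↔ a ∈ Set.Icc 0 1 ∧ b ∈ Set.Icc 0 (1 - a) := by
      simp only [stdTriangle, Set.mem_ofPred_eq, Set.mem_Icc]
      constructor
      · rintro ⟨ha, hb, hab⟩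
        exact ⟨⟨ha, by linarith⟩, hb, by linarith⟩
      · rintro ⟨⟨ha, -⟩, hb, hab⟩
        exact ⟨ha, hb, by linarith⟩
    classical
    simp only [Set.indicator_apply, hmem, ite_and]
  rw [← integral_indicator hmeas, Measure.volume_eq_prod, integral_prod _ hint,
    intervalIntegral.integral_of_le zero_le_one, ← integral_Icc_eq_integral_Ioc,
    ← integral_indicator measurableSet_Icc]
  refine integral_congr_ae (Filter.Eventually.of_forall fun a => ?_)
  simp only [hslice]
  by_cases ha : a ∈ Set.Icc (0 : ℝ) 1
  · simp only [Set.indicator_of_mem ha]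
    rw [integral_indicator measurableSet_Icc, integral_Icc_eq_integral_Ioc,
      intervalIntegral.integral_of_le (by linarith [ha.2])]
  · simp only [Set.indicator_of_notMem ha, integral_zero]

end Integration

/-! ### The divergence theorem in the triangle -/

section Divergence

variable {F : Type*} [NormedAddCommGroup F] [NormedSpace ℝ F] {p : Fin 3 → E3}

/-- The mean value of `g` along the `i`-th side, parametrised from `p_{i+1}` to `p_{i-1}`. -/
def sideMean (p : Fin 3 → E3) (g : E3 → F) (i : Fin 3) : F :=
  ∫ t in (0 : ℝ)..1, g (AffineMap.lineMap (p (i + 1)) (p (i - 1)) t)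

/-- The integral of `g` along the `i`-th side with respect to arc length. -/
def sideIntegral (p : Fin 3 → E3) (g : E3 → F) (i : Fin 3) : F := sideLen p i • sideMean p g i

lemma triangle_comp_add_right (p : Fin 3 → E3) (j : Fin 3) :
    triangle (fun i => p (i + j)) = triangle p :=
  congrArg (convexHull ℝ) ((Equiv.addRight j).surjective.range_comp p)

lemma side_comp_add_right (p : Fin 3 → E3) (i j : Fin 3) :
    side (fun i => p (i + j)) i = side p (i + j) := by
  rw [side, side, add_right_comm, sub_add_eq_add_sub]

lemma areaVec_comp_add_right (p : Fin 3 → E3) (j : Fin 3) :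
    areaVec (fun i => p (i + j)) = areaVec p := by
  rw [← cross_side_side_add_one _ 0, side_comp_add_right, side_comp_add_right, add_right_comm,
    cross_side_side_add_one]

lemma sideMean_comp_add_right (p : Fin 3 → E3) (g : E3 → F) (i j : Fin 3) :
    sideMean (fun i => p (i + j)) g i = sideMean p g (i + j) := by
  simp only [sideMean, add_right_comm i 1 j, sub_add_eq_add_sub]

lemma hasDerivAt_triMap_snd (p : Fin 3 → E3) (a b : ℝ) :
    HasDerivAt (fun b => triMap p (a, b)) (p 2 - p 0) b := by
  simpa [triMap] using
    (((hasDerivAt_id b).smul_const (p 2 - p 0)).const_add (a • (p 1 - p 0))).const_add (p 0)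

lemma integral_comp_triMap_one_sub (p : Fin 3 → E3) (g : E3 → F) :
    ∫ a in (0 : ℝ)..1, g (triMap p (a, 1 - a)) = sideMean p g 0 := by
  have hreverse := intervalIntegral.integral_comp_sub_left (a := 0) (b := 1)
    (fun t => g (AffineMap.lineMap (p 1) (p 2) t)) 1
  rw [sub_self, sub_zero] at hreverse
  refine Eq.trans (intervalIntegral.integral_congr fun a _ => congrArg g ?_) hreverse
  rw [triMap, AffineMap.lineMap_apply_module]
  module

lemma integral_comp_triMap_zero (p : Fin 3 → E3) (g : E3 → F) :
    ∫ a in (0 : ℝ)..1, g (triMap p (a, 0)) = sideMean p g 2 := by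
  refine intervalIntegral.integral_congr fun a _ => congrArg g ?_
  change _ = AffineMap.lineMap (p 0) (p 1) a
  rw [triMap, AffineMap.lineMap_apply_module]
  module

variable [CompleteSpace F]

lemma integral_stdTriangle_of_hasDerivAt_snd {G G' : ℝ × ℝ → F} (hG : ContinuousOn G stdTriangle)
    (hderiv : ∀ a b, (a, b) ∈ stdTriangle → HasDerivAt (fun b => G (a, b)) (G' (a, b)) b)
    (hG' : ContinuousOn G' stdTriangle) :
    ∫ x in stdTriangle, G' x
      = (∫ a in (0 : ℝ)..1, G (a, 1 - a)) - ∫ a in (0 : ℝ)..1, G (a, 0) := by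
  have hmem {a b : ℝ} (ha : a ∈ Set.uIcc (0 : ℝ) 1) (hb : b ∈ Set.uIcc 0 (1 - a)) :
      (a, b) ∈ stdTriangle := by
    rw [Set.uIcc_of_le zero_le_one] at ha
    rw [Set.uIcc_of_le (sub_nonneg.2 ha.2)] at hb
    exact ⟨ha.1, hb.1, show a + b ≤ 1 by linarith [hb.2]⟩
  have hslice (a : ℝ) (ha : a ∈ Set.uIcc (0 : ℝ) 1) :
      ∫ b in (0 : ℝ)..(1 - a), G' (a, b) = G (a, 1 - a) - G (a, 0) :=
    intervalIntegral.integral_eq_sub_of_hasDerivAt (fun b hb => hderiv a b (hmem ha hb))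
      (hG'.comp (by fun_prop) fun b hb => hmem ha hb).intervalIntegrable
  rw [integral_stdTriangle hG', intervalIntegral.integral_congr hslice]
  exact intervalIntegral.integral_sub
    (hG.comp (by fun_prop) fun a ha => hmem ha Set.right_mem_uIcc).intervalIntegrable
    (hG.comp (by fun_prop) fun a ha => hmem ha Set.left_mem_uIcc).intervalIntegrable

variable {g : E3 → F} {g' : E3 → E3 →L[ℝ] F}

lemma integral_fderiv_side_one (hg : ∀ r ∈ triangle p, HasFDerivAt g (g' r) r)
    (hg' : ContinuousOn g' (triangle p)) :
    ∫ r in triangle p, g' r (side p 1) ∂μHE[2]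
      = ‖areaVec p‖ • (sideMean p g 2 - sideMean p g 0) := by
  have hmaps : Set.MapsTo (triMap p) stdTriangle (triangle p) := fun x hx => triMap_mem hx
  have hgcont : ContinuousOn g (triangle p) :=
    fun r hr => (hg r hr).continuousAt.continuousWithinAt
  have hplanar := integral_stdTriangle_of_hasDerivAt_snd (G := fun x => g (triMap p x))
    (G' := fun x => g' (triMap p x) (p 2 - p 0))
    (hgcont.comp (continuous_triMap p).continuousOn hmaps)
    (fun a b hab => (hg _ (hmaps hab)).comp_hasDerivAt b (hasDerivAt_triMap_snd p a b))
    ((hg'.comp (continuous_triMap p).continuousOn hmaps).clm_apply continuousOn_const)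
  have hside_one : side p 1 = -(p 2 - p 0) := (neg_sub _ _).symm
  rw [integral_triangle (hg'.clm_apply continuousOn_const), hside_one]
  simp only [map_neg, integral_neg]
  rw [hplanar, integral_comp_triMap_one_sub, integral_comp_triMap_zero, neg_sub]

lemma integral_fderiv_side (hg : ∀ r ∈ triangle p, HasFDerivAt g (g' r) r)
    (hg' : ContinuousOn g' (triangle p)) (i : Fin 3) :
    ∫ r in triangle p, g' r (side p i) ∂μHE[2]
      = ‖areaVec p‖ • (sideMean p g (i + 1) - sideMean p g (i - 1)) := by
  have hshift := integral_fderiv_side_one (p := fun k => p (k + (i - 1))) (g := g) (g' := g')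
  rw [triangle_comp_add_right, side_comp_add_right, areaVec_comp_add_right,
    sideMean_comp_add_right, sideMean_comp_add_right, add_sub_cancel, zero_add,
    show (2 : Fin 3) = 1 + 1 from rfl, add_assoc, add_sub_cancel, add_comm] at hshift
  exact hshift hg hg'

lemma integral_fderiv_tangent (hp : AffineIndependent ℝ p)
    (hg : ∀ r ∈ triangle p, HasFDerivAt g (g' r) r) (hg' : ContinuousOn g' (triangle p)) {d : E3}
    (hd : ⟪d, wHat p⟫ = 0) :
    ∫ r in triangle p, g' r d ∂μHE[2] = ∑ i, ⟪d, mHat p i⟫ • sideIntegral p g i := by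
  have hint (i : Fin 3) : IntegrableOn (fun r => g' r (side p i)) (triangle p) μHE[2] :=
    integrableOn_triangle (hg'.clm_apply continuousOn_const)
  have hkey : ‖areaVec p‖ • ∫ r in triangle p, g' r d ∂μHE[2]
      = ‖areaVec p‖ • ∑ i, ⟪d, mHat p i⟫ • sideIntegral p g i := by
    calc _ = ∫ r in triangle p, g' r (‖areaVec p‖ • d) ∂μHE[2] := by
            simp only [map_smul, integral_smul]
      _ = (sideLen p 2 * ⟪d, mHat p 2⟫) • ∫ r in triangle p, g' r (side p 1) ∂μHE[2]
          - (sideLen p 1 * ⟪d, mHat p 1⟫) • ∫ r in triangle p, g' r (side p 2) ∂μHE[2] := by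
            simp only [norm_areaVec_smul_of_inner_wHat_eq_zero hp hd, map_sub, map_smul]
            rw [← integral_smul, ← integral_smul]
            exact integral_sub ((hint 1).smul _) ((hint 2).smul _)
      _ = _ := by
            have hsum := sum_sideLen_mul_inner_mHat p d
            have h1 : ∫ r in triangle p, g' r (side p 1) ∂μHE[2]
                = ‖areaVec p‖ • (sideMean p g 2 - sideMean p g 0) := integral_fderiv_side hg hg' 1
            have h2 : ∫ r in triangle p, g' r (side p 2) ∂μHE[2]
                = ‖areaVec p‖ • (sideMean p g 0 - sideMean p g 1) := integral_fderiv_side hg hg' 2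
            rw [Fin.sum_univ_three] at hsum
            simp only [h1, h2, Fin.sum_univ_three, sideIntegral]
            linear_combination (norm := module)
              (-1 : ℝ) • congrArg (· • (‖areaVec p‖ • sideMean p g 0)) hsum
  exact smul_right_injective _ (norm_ne_zero_iff.2 (areaVec_ne_zero hp)) hkey

end Divergence

/-! ### Integrals along the sides -/

section Primitives

variable {c : ℝ}

lemma sqrt_sq_add_pos (hc : 0 < c) (s : ℝ) : 0 < √(s ^ 2 + c) := Real.sqrt_pos.2 (by positivity)

lemma sqrt_sq_add_add_pos (hc : 0 < c) (s : ℝ) : 0 < √(s ^ 2 + c) + s := by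
  have hlt : |s| < √(s ^ 2 + c) := Real.lt_sqrt_of_sq_lt (by rw [sq_abs]; linarith)
  linarith [neg_abs_le s]

lemma hasDerivAt_sqrt_sq_add (hc : 0 < c) (s : ℝ) :
    HasDerivAt (fun s => √(s ^ 2 + c)) (s / √(s ^ 2 + c)) s := by
  refine (((hasDerivAt_pow 2 s).add_const c).sqrt (by positivity)).congr_deriv ?_
  norm_num
  ring

lemma integral_inv_sqrt_sq_add_pow_three (hc : 0 < c) (a b : ℝ) :
    ∫ s in a..b, (√(s ^ 2 + c) ^ 3)⁻¹ = 1 / c * (b / √(b ^ 2 + c) - a / √(a ^ 2 + c)) := by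
  have hderiv (s : ℝ) :
      HasDerivAt (fun s => 1 / c * (s / √(s ^ 2 + c))) (√(s ^ 2 + c) ^ 3)⁻¹ s := by
    have hpos := sqrt_sq_add_pos hc s
    have hsq : √(s ^ 2 + c) ^ 2 = s ^ 2 + c := Real.sq_sqrt (by positivity)
    refine (((hasDerivAt_id' s).fun_div (hasDerivAt_sqrt_sq_add hc s) hpos.ne').const_mul
      (1 / c)).congr_deriv ?_
    field_simp
    linear_combination hsq
  rw [intervalIntegral.integral_eq_sub_of_hasDerivAt (fun s _ => hderiv s), ← mul_sub]
  exact Continuous.intervalIntegrable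
    (.inv₀ (by fun_prop) fun s => (pow_pos (sqrt_sq_add_pos hc s) 3).ne') _ _

lemma integral_mul_inv_sqrt_sq_add_pow_three (hc : 0 < c) (a b : ℝ) :
    ∫ s in a..b, s * (√(s ^ 2 + c) ^ 3)⁻¹ = (√(a ^ 2 + c))⁻¹ - (√(b ^ 2 + c))⁻¹ := by
  have hderiv (s : ℝ) :
      HasDerivAt (fun s => -(√(s ^ 2 + c))⁻¹) (s * (√(s ^ 2 + c) ^ 3)⁻¹) s := by
    have hpos := sqrt_sq_add_pos hc s
    refine ((hasDerivAt_sqrt_sq_add hc s).fun_inv hpos.ne').fun_neg.congr_deriv ?_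
    field_simp
  rw [intervalIntegral.integral_eq_sub_of_hasDerivAt (fun s _ => hderiv s), neg_sub_neg]
  exact Continuous.intervalIntegrable (continuous_id.mul
    (.inv₀ (by fun_prop) fun s => (pow_pos (sqrt_sq_add_pos hc s) 3).ne')) _ _

lemma integral_inv_sqrt_sq_add (hc : 0 < c) (a b : ℝ) :
    ∫ s in a..b, (√(s ^ 2 + c))⁻¹ = Real.log ((√(b ^ 2 + c) + b) / (√(a ^ 2 + c) + a)) := by
  have hderiv (s : ℝ) :
      HasDerivAt (fun s => Real.log (√(s ^ 2 + c) + s)) (√(s ^ 2 + c))⁻¹ s := by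
    have := sqrt_sq_add_pos hc s
    have hpos := sqrt_sq_add_add_pos hc s
    refine (((hasDerivAt_sqrt_sq_add hc s).fun_add (hasDerivAt_id' s)).log
      hpos.ne').congr_deriv ?_
    field_simp
    ring
  rw [Real.log_div (sqrt_sq_add_add_pos hc b).ne' (sqrt_sq_add_add_pos hc a).ne',
    intervalIntegral.integral_eq_sub_of_hasDerivAt fun s _ => hderiv s]
  exact Continuous.intervalIntegrable
    (.inv₀ (by fun_prop) fun s => (sqrt_sq_add_pos hc s).ne') _ _

lemma hasDerivAt_arctan_div_add_mul_sqrt (hc : 0 < c) {t k : ℝ} (hk : 0 ≤ k)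
    (htk : c = t ^ 2 + k ^ 2) (s : ℝ) :
    HasDerivAt (fun s => Real.arctan (t * s / (c + k * √(s ^ 2 + c))))
      (t * (√(s ^ 2 + c) * (√(s ^ 2 + c) + k))⁻¹) s := by
  have hden : 0 < c + k * √(s ^ 2 + c) := by positivity
  refine (((hasDerivAt_id' s).const_mul t).fun_div
    (((hasDerivAt_sqrt_sq_add hc s).const_mul k).const_add c) hden.ne').arctan.congr_deriv ?_
  have hN := sqrt_sq_add_pos hc s
  have hsq : √(s ^ 2 + c) ^ 2 = s ^ 2 + c := Real.sq_sqrt (by positivity)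
  set N := √(s ^ 2 + c)
  have : 0 < N + k := by positivity
  have hone_add : 1 + (t * s / (c + k * N)) ^ 2 = c * (N + k) ^ 2 / (c + k * N) ^ 2 := by
    rw [eq_div_iff (by positivity), div_pow, one_add_mul, div_mul_cancel₀ _ (by positivity)]
    linear_combination (-t ^ 2) * hsq + (c - N ^ 2) * htk
  rw [hone_add]
  field_simp
  linear_combination t * k * hsq

lemma mul_integral_inv_sqrt_sq_add_mul_add (hc : 0 < c) {t k : ℝ} (hk : 0 ≤ k)
    (htk : c = t ^ 2 + k ^ 2) (a b : ℝ) :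
    t * ∫ s in a..b, (√(s ^ 2 + c) * (√(s ^ 2 + c) + k))⁻¹
      = Real.arctan (t * b / (c + k * √(b ^ 2 + c)))
        - Real.arctan (t * a / (c + k * √(a ^ 2 + c))) := by
  rw [← intervalIntegral.integral_const_mul, intervalIntegral.integral_eq_sub_of_hasDerivAt
    fun s _ => hasDerivAt_arctan_div_add_mul_sqrt hc hk htk s]
  refine Continuous.intervalIntegrable (continuous_const.mul (.inv₀ (by fun_prop) fun s => ?_)) _ _
  have := sqrt_sq_add_pos hc s
  positivity

end Primitives

lemma continuousOn_inv_pow_three : ContinuousOn (fun x : ℝ => (x ^ 3)⁻¹) (Set.Ioi 0) :=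
  .inv₀ (by fun_prop) fun _ hx => (pow_pos hx 3).ne'

section Sides

variable {p : Fin 3 → E3} {r₀ : E3} {i : Fin 3}

/-- The point of the line through the `i`-th side at signed distance `s` (along `ŝ_i`) from the
foot of the perpendicular dropped from `ρ`. -/
def sidePoint (p : Fin 3 → E3) (r₀ : E3) (i : Fin 3) (s : ℝ) : E3 :=
  rho p r₀ + t0 p r₀ i • mHat p i + s • sHat p i

lemma sidePoint_sub (hp : AffineIndependent ℝ p) (r₀ : E3) (i : Fin 3) (s : ℝ) :
    sidePoint p r₀ i s - r₀ = t0 p r₀ i • mHat p i + s • sHat p i + w0 p r₀ • wHat p := by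
  rw [← rho_sub hp, sidePoint]
  abel

lemma inner_sidePoint_sub (hp : AffineIndependent ℝ p) (r₀ : E3) (i : Fin 3) (s : ℝ) {a : E3}
    (ha : ⟪a, wHat p⟫ = 0) :
    ⟪a, sidePoint p r₀ i s - r₀⟫ = ⟪a, mHat p i⟫ * t0 p r₀ i + ⟪a, sHat p i⟫ * s := by
  simp only [sidePoint_sub hp, inner_add_right, inner_smul_right, ha]
  ring

lemma norm_sidePoint_sub (hp : AffineIndependent ℝ p) (r₀ : E3) (i : Fin 3) (s : ℝ) :
    ‖sidePoint p r₀ i s - r₀‖ = √(s ^ 2 + R0 p r₀ i ^ 2) := by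
  rw [← Real.sqrt_sq (norm_nonneg _), ← real_inner_self_eq_norm_sq, R0_sq]
  nth_rw 1 [sidePoint_sub hp]
  have hw : ⟪wHat p, sidePoint p r₀ i s - r₀⟫ = w0 p r₀ := by
    simp only [sidePoint_sub hp, inner_add_right, inner_smul_right,
      real_inner_comm (mHat p i) (wHat p), inner_mHat_wHat, real_inner_comm (sHat p i) (wHat p),
      inner_sHat_wHat hp, real_inner_self_eq_norm_sq, norm_wHat hp]
    ring
  simp only [inner_add_left, inner_smul_left, conj_trivial, hw,
    inner_sidePoint_sub hp r₀ i s (inner_mHat_wHat p i),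
    inner_sidePoint_sub hp r₀ i s (inner_sHat_wHat hp i), real_inner_self_eq_norm_sq,
    norm_mHat hp, norm_sHat hp, inner_mHat_sHat, real_inner_comm (mHat p i) (sHat p i)]
  congr 1
  ring

lemma sideIntegral_eq_integral_sidePoint {F : Type*} [NormedAddCommGroup F] [NormedSpace ℝ F]
    (hp : AffineIndependent ℝ p) (r₀ : E3) (g : E3 → F) (i : Fin 3) :
    sideIntegral p g i = ∫ s in sMinus p r₀ i..sPlus p r₀ i, g (sidePoint p r₀ i s) := by
  have hpoint (t : ℝ) : AffineMap.lineMap (p (i + 1)) (p (i - 1)) t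
      = sidePoint p r₀ i (sMinus p r₀ i + sideLen p i * t) := by
    have hnode := sub_eq_iff_eq_add.1 (node_sub_rho hp r₀ i)
    rw [AffineMap.lineMap_apply, vsub_eq_sub, vadd_eq_add, ← side, ← sideLen_smul_sHat, sidePoint]
    linear_combination (norm := module) hnode
  simp only [sideIntegral, sideMean, hpoint]
  rw [intervalIntegral.smul_integral_comp_add_mul (fun s => g (sidePoint p r₀ i s)), mul_zero,
    add_zero, mul_one, ← sPlus_eq_add_sideLen hp]

lemma sideIntegral_comp_norm_sub (hp : AffineIndependent ℝ p) (r₀ : E3) (φ : ℝ → ℝ) (i : Fin 3) :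
    sideIntegral p (fun r => φ ‖r - r₀‖) i
      = ∫ s in sMinus p r₀ i..sPlus p r₀ i, φ √(s ^ 2 + R0 p r₀ i ^ 2) := by
  simp only [sideIntegral_eq_integral_sidePoint hp r₀, norm_sidePoint_sub hp]

lemma sideIntegral_inner_mul_comp_norm_sub (hp : AffineIndependent ℝ p) (h0 : 0 < R0 p r₀ i)
    {φ : ℝ → ℝ} (hφ : ContinuousOn φ (Set.Ioi 0)) {a : E3} (ha : ⟪a, wHat p⟫ = 0) :
    sideIntegral p (fun r => ⟪a, r - r₀⟫ * φ ‖r - r₀‖) i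
      = ⟪a, mHat p i⟫ * (t0 p r₀ i * ∫ s in sMinus p r₀ i..sPlus p r₀ i,
          φ √(s ^ 2 + R0 p r₀ i ^ 2))
        + ⟪a, sHat p i⟫ * ∫ s in sMinus p r₀ i..sPlus p r₀ i, s * φ √(s ^ 2 + R0 p r₀ i ^ 2) := by
  have hcont : Continuous fun s => φ √(s ^ 2 + R0 p r₀ i ^ 2) :=
    hφ.comp_continuous (by fun_prop) fun s => sqrt_sq_add_pos (pow_pos h0 2) s
  simp only [sideIntegral_eq_integral_sidePoint hp r₀, inner_sidePoint_sub hp r₀ i _ ha,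
    norm_sidePoint_sub hp, add_mul, mul_assoc]
  rw [← intervalIntegral.integral_const_mul, ← intervalIntegral.integral_const_mul,
    ← intervalIntegral.integral_const_mul, ← intervalIntegral.integral_add]
  exacts [((hcont.const_mul _).const_mul _).intervalIntegrable _ _,
    ((continuous_id.mul hcont).const_mul _).intervalIntegrable _ _]

lemma sum_inner_axis_mHat_mul_sideIntegral (hp : AffineIndependent ℝ p) (h0 : 0 < R0 p r₀ i)
    {φ : ℝ → ℝ} (hφ : ContinuousOn φ (Set.Ioi 0)) :
    ∑ k, ⟪axis p k, mHat p i⟫ * sideIntegral p (fun r => ⟪axis p k, r - r₀⟫ * φ ‖r - r₀‖) i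
      = t0 p r₀ i * sideIntegral p (fun r => φ ‖r - r₀‖) i := by
  have hm := sum_inner_axis_mul_inner_axis hp (mHat p i) (mHat p i)
  have hs := sum_inner_axis_mul_inner_axis hp (mHat p i) (sHat p i)
  rw [real_inner_comm (mHat p i) (wHat p), inner_mHat_wHat, zero_mul, sub_zero] at hm hs
  rw [real_inner_self_eq_norm_sq, norm_mHat hp, one_pow] at hm
  rw [inner_mHat_sHat] at hs
  simp only [sideIntegral_inner_mul_comp_norm_sub hp h0 hφ (inner_axis_wHat hp _), mul_add,
    ← mul_assoc _ ⟪_, _⟫, Finset.sum_add_distrib, ← Finset.sum_mul, hm, hs, one_mul, zero_mul,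
    add_zero, sideIntegral_comp_norm_sub hp]

lemma sideIntegral_inv_norm_sub_pow_three (hp : AffineIndependent ℝ p) (h0 : 0 < R0 p r₀ i) :
    sideIntegral p (fun r => (‖r - r₀‖ ^ 3)⁻¹) i = Rs p r₀ i := by
  rw [sideIntegral_comp_norm_sub hp r₀ fun x => (x ^ 3)⁻¹,
    integral_inv_sqrt_sq_add_pow_three (pow_pos h0 2), Rs, RPlus_eq_sqrt, RMinus_eq_sqrt]

lemma sideIntegral_inv_norm_sub (hp : AffineIndependent ℝ p) (h0 : 0 < R0 p r₀ i) :
    sideIntegral p (fun r => ‖r - r₀‖⁻¹) i = f2 p r₀ i := by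
  rw [sideIntegral_comp_norm_sub hp r₀ fun x => x⁻¹, integral_inv_sqrt_sq_add (pow_pos h0 2), f2,
    RPlus_eq_sqrt, RMinus_eq_sqrt]

lemma sideIntegral_inner_mul_inv_norm_sub_pow_three (hp : AffineIndependent ℝ p)
    (h0 : 0 < R0 p r₀ i) {a : E3} (ha : ⟪a, wHat p⟫ = 0) :
    sideIntegral p (fun r => ⟪a, r - r₀⟫ * (‖r - r₀‖ ^ 3)⁻¹) i
      = ⟪a, Rd p r₀ i • sHat p i + Rs p r₀ i • (t0 p r₀ i • mHat p i)⟫ := by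
  rw [sideIntegral_inner_mul_comp_norm_sub hp h0 continuousOn_inv_pow_three ha,
    integral_inv_sqrt_sq_add_pow_three (pow_pos h0 2),
    integral_mul_inv_sqrt_sq_add_pow_three (pow_pos h0 2), Rs, Rd, RPlus_eq_sqrt, RMinus_eq_sqrt,
    inner_add_right, inner_smul_right, inner_smul_right, inner_smul_right]
  ring

lemma t0_mul_sideIntegral_inv_mul_add_abs_w0 (hp : AffineIndependent ℝ p) (h0 : 0 < R0 p r₀ i) :
    t0 p r₀ i * sideIntegral p (fun r => (‖r - r₀‖ * (‖r - r₀‖ + |w0 p r₀|))⁻¹) i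
      = Real.arctan (t0 p r₀ i * sPlus p r₀ i / (R0 p r₀ i ^ 2 + |w0 p r₀| * RPlus p r₀ i))
        - Real.arctan
          (t0 p r₀ i * sMinus p r₀ i / (R0 p r₀ i ^ 2 + |w0 p r₀| * RMinus p r₀ i)) := by
  rw [sideIntegral_comp_norm_sub hp r₀ fun x => (x * (x + |w0 p r₀|))⁻¹,
    mul_integral_inv_sqrt_sq_add_mul_add (pow_pos h0 2) (abs_nonneg _) (by rw [R0_sq, sq_abs]),
    RPlus_eq_sqrt, RMinus_eq_sqrt]

end Sides

/-! ### Radial fields -/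

section Radial

variable {E : Type*} [NormedAddCommGroup E] {r₀ r : E} {φ : ℝ → ℝ} {c : ℝ}

lemma continuousOn_comp_norm_sub {s : Set E} (hr₀ : r₀ ∉ s) (hφ : ContinuousOn φ (Set.Ioi 0)) :
    ContinuousOn (fun r => φ ‖r - r₀‖) s :=
  hφ.comp (by fun_prop) fun _ hr =>
    norm_sub_pos_iff.2 (ne_of_mem_of_not_mem hr hr₀)

variable [InnerProductSpace ℝ E]

lemma hasFDerivAt_comp_norm_sub (hr : r ≠ r₀) (hφ : HasDerivAt φ (‖r - r₀‖ * c) ‖r - r₀‖) :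
    HasFDerivAt (fun r => φ ‖r - r₀‖) (c • innerSL ℝ (r - r₀)) r := by
  have hnorm : ‖r - r₀‖ ≠ 0 := norm_ne_zero_iff.2 (sub_ne_zero.2 hr)
  have hsqrt : HasFDerivAt (fun r => √(‖r - r₀‖ ^ 2)) (‖r - r₀‖⁻¹ • innerSL ℝ (r - r₀)) r := by
    refine (((hasFDerivAt_id r).sub_const r₀).norm_sq.sqrt
      (pow_ne_zero 2 hnorm)).congr_fderiv ?_
    ext x
    simp only [id_eq, Real.sqrt_sq (norm_nonneg _), one_div, mul_inv_rev, map_sub,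
      ContinuousLinearMap.comp_id, smul_apply, sub_apply, coe_innerSL_apply, nsmul_eq_mul,
      Nat.cast_ofNat, smul_eq_mul]
    ring
  simp only [Real.sqrt_sq (norm_nonneg _)] at hsqrt
  refine (hφ.comp_hasFDerivAt r hsqrt).congr_fderiv ?_
  rw [smul_smul, mul_comm ‖r - r₀‖, mul_inv_cancel_right₀ hnorm]

lemma hasFDerivAt_inner_mul_comp_norm_sub (a : E) (hr : r ≠ r₀)
    (hφ : HasDerivAt φ (‖r - r₀‖ * c) ‖r - r₀‖) :
    HasFDerivAt (fun r => ⟪a, r - r₀⟫ * φ ‖r - r₀‖)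
      (⟪a, r - r₀⟫ • c • innerSL ℝ (r - r₀) + φ ‖r - r₀‖ • innerSL ℝ a) r :=
  ((innerSL ℝ a).hasFDerivAt.comp r ((hasFDerivAt_id r).sub_const r₀)).fun_mul
    (hasFDerivAt_comp_norm_sub hr hφ)

end Radial

lemma hasDerivAt_inv_pow_three {x : ℝ} (hx : 0 < x) :
    HasDerivAt (fun x : ℝ => (x ^ 3)⁻¹) (x * (-3 * (x ^ 5)⁻¹)) x := by
  refine ((hasDerivAt_pow 3 x).fun_inv (pow_ne_zero 3 hx.ne')).congr_deriv ?_
  norm_num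
  field_simp

lemma hasDerivAt_inv_eq_mul {x : ℝ} (hx : 0 < x) :
    HasDerivAt (fun x : ℝ => x⁻¹) (x * -(x ^ 3)⁻¹) x := by
  refine (hasDerivAt_inv hx.ne').congr_deriv ?_
  field_simp

lemma hasDerivAt_inv_mul_add {h x : ℝ} (hh : 0 ≤ h) (hx : 0 < x) :
    HasDerivAt (fun x : ℝ => (x * (x + h))⁻¹)
      (x * (-(2 * x + h) * (x ^ 3 * (x + h) ^ 2)⁻¹)) x := by
  refine (((hasDerivAt_id' x).fun_mul ((hasDerivAt_id' x).add_const h)).fun_inv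
    (by positivity)).congr_deriv ?_
  field_simp
  ring

lemma continuousOn_inv_pow_five : ContinuousOn (fun x : ℝ => -3 * (x ^ 5)⁻¹) (Set.Ioi 0) :=
  continuousOn_const.mul (.inv₀ (by fun_prop) fun _ hx => (pow_pos hx 5).ne')

section RadialIntegrals

variable {p : Fin 3 → E3} {r₀ : E3} {φ ψ : ℝ → ℝ}

lemma inner_wHat_sub_of_mem_triangle (hp : AffineIndependent ℝ p) (r₀ : E3) {r : E3}
    (hr : r ∈ triangle p) : ⟪wHat p, r - r₀⟫ = w0 p r₀ := by
  have hplane : triangle p ⊆ {r | ⟪wHat p, r⟫ = ⟪wHat p, p 0⟫} :=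
    convexHull_min
      (Set.range_subset_iff.2 fun i => by
        simpa only [Set.mem_ofPred_eq, real_inner_comm] using inner_node_wHat hp i)
      (convex_hyperplane (innerSL ℝ (wHat p)).isLinear _)
  have hr' : ⟪wHat p, r⟫ = ⟪wHat p, p 0⟫ := hplane hr
  rw [w0, inner_sub_left, inner_sub_right, hr', real_inner_comm (p 0), real_inner_comm r₀]
  ring

lemma integral_mul_inner_sub (hp : AffineIndependent ℝ p) (hT : r₀ ∉ triangle p)
    (hφ : ∀ x, 0 < x → HasDerivAt φ (x * ψ x) x) (hψ : ContinuousOn ψ (Set.Ioi 0)) {d : E3}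
    (hd : ⟪d, wHat p⟫ = 0) :
    ∫ r in triangle p, ψ ‖r - r₀‖ * ⟪d, r - r₀⟫ ∂μHE[2]
      = ∑ i, ⟪d, mHat p i⟫ * sideIntegral p (fun r => φ ‖r - r₀‖) i := by
  have hderiv (r) (hr : r ∈ triangle p) := hasFDerivAt_comp_norm_sub
    (ne_of_mem_of_not_mem hr hT) (hφ _ (norm_sub_pos_iff.2 (ne_of_mem_of_not_mem hr hT)))
  have hcont : ContinuousOn (fun r => ψ ‖r - r₀‖ • innerSL ℝ (r - r₀)) (triangle p) :=
    (continuousOn_comp_norm_sub hT hψ).smul (by fun_prop)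
  simpa only [smul_apply, innerSL_apply_apply, smul_eq_mul, real_inner_comm] using
    integral_fderiv_tangent hp hderiv hcont hd

lemma integral_inner_mul_add_mul_inner_mul_inner (hp : AffineIndependent ℝ p)
    (hT : r₀ ∉ triangle p) (hφ : ∀ x, 0 < x → HasDerivAt φ (x * ψ x) x)
    (hψ : ContinuousOn ψ (Set.Ioi 0)) (a : E3) {d : E3} (hd : ⟪d, wHat p⟫ = 0) :
    ∫ r in triangle p, (⟪a, d⟫ * φ ‖r - r₀‖ + ψ ‖r - r₀‖ * (⟪a, r - r₀⟫ * ⟪d, r - r₀⟫)) ∂μHE[2]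
      = ∑ i, ⟪d, mHat p i⟫ * sideIntegral p (fun r => ⟪a, r - r₀⟫ * φ ‖r - r₀‖) i := by
  have hderiv (r) (hr : r ∈ triangle p) := hasFDerivAt_inner_mul_comp_norm_sub a
    (ne_of_mem_of_not_mem hr hT) (hφ _ (norm_sub_pos_iff.2 (ne_of_mem_of_not_mem hr hT)))
  have hφ' : ContinuousOn φ (Set.Ioi 0) := fun x hx => (hφ x hx).continuousAt.continuousWithinAt
  have hcont : ContinuousOn (fun r => ⟪a, r - r₀⟫ • ψ ‖r - r₀‖ • innerSL ℝ (r - r₀)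
      + φ ‖r - r₀‖ • innerSL ℝ a) (triangle p) := by
    have hinner : Continuous fun r => ⟪a, r - r₀⟫ := by fun_prop
    have hgrad : Continuous fun r => innerSL ℝ (r - r₀) := by fun_prop
    exact .add (.smul hinner.continuousOn
      (.smul (continuousOn_comp_norm_sub hT hψ) hgrad.continuousOn))
      (.smul (continuousOn_comp_norm_sub hT hφ') continuousOn_const)
  refine (integral_congr_ae (.of_forall fun r => ?_)).trans
    (integral_fderiv_tangent hp hderiv hcont hd)
  simp only [add_apply, smul_apply, innerSL_apply_apply, smul_eq_mul, real_inner_comm d]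
  ring

lemma integral_two_mul_add_mul_norm_sq_sub (hp : AffineIndependent ℝ p) (hT : r₀ ∉ triangle p)
    (h0 : ∀ i, 0 < R0 p r₀ i) (hφ : ∀ x, 0 < x → HasDerivAt φ (x * ψ x) x)
    (hψ : ContinuousOn ψ (Set.Ioi 0)) :
    ∫ r in triangle p, (2 * φ ‖r - r₀‖ + ψ ‖r - r₀‖ * (‖r - r₀‖ ^ 2 - w0 p r₀ ^ 2)) ∂μHE[2]
      = ∑ i, t0 p r₀ i * sideIntegral p (fun r => φ ‖r - r₀‖) i := by
  have hφ' : ContinuousOn φ (Set.Ioi 0) := fun x hx => (hφ x hx).continuousAt.continuousWithinAt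
  have hint (k : Fin 2) : IntegrableOn (fun r => ⟪axis p k, axis p k⟫ * φ ‖r - r₀‖
      + ψ ‖r - r₀‖ * (⟪axis p k, r - r₀⟫ * ⟪axis p k, r - r₀⟫)) (triangle p) μHE[2] :=
    integrableOn_triangle ((continuousOn_const.mul (continuousOn_comp_norm_sub hT hφ')).add
      ((continuousOn_comp_norm_sub hT hψ).mul (by fun_prop)))
  have hdiv : Set.EqOn
      (fun r => 2 * φ ‖r - r₀‖ + ψ ‖r - r₀‖ * (‖r - r₀‖ ^ 2 - w0 p r₀ ^ 2))
      (fun r => ∑ k, (⟪axis p k, axis p k⟫ * φ ‖r - r₀‖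
        + ψ ‖r - r₀‖ * (⟪axis p k, r - r₀⟫ * ⟪axis p k, r - r₀⟫))) (triangle p) := fun r hr => by
    simp only [Finset.sum_add_distrib, ← Finset.sum_mul, ← Finset.mul_sum,
      sum_inner_axis_mul_inner_axis hp, inner_wHat_sub_of_mem_triangle hp r₀ hr,
      real_inner_self_eq_norm_sq, norm_axis hp, Fin.sum_univ_two]
    ring
  rw [setIntegral_congr_fun (isCompact_triangle p).measurableSet hdiv,
    integral_finsetSum _ fun k _ => hint k]
  simp only [integral_inner_mul_add_mul_inner_mul_inner hp hT hφ hψ _ (inner_axis_wHat hp _)]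
  rw [Finset.sum_comm]
  simp only [sum_inner_axis_mHat_mul_sideIntegral hp (h0 _) hφ']

end RadialIntegrals

lemma real_sign_mul_abs (x : ℝ) : Real.sign x * |x| = x := by
  rcases lt_trichotomy x 0 with hx | rfl | hx
  · rw [Real.sign_of_neg hx, abs_of_neg hx, neg_one_mul, neg_neg]
  · rw [abs_zero, mul_zero]
  · rw [Real.sign_of_pos hx, abs_of_pos hx, one_mul]

section SurfaceIntegrals

variable {p : Fin 3 → E3} {r₀ : E3} {d : E3}

lemma continuousOn_inv_norm_sub_pow (hT : r₀ ∉ triangle p) (n : ℕ) :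
    ContinuousOn (fun r => (‖r - r₀‖ ^ n)⁻¹) (triangle p) :=
  continuousOn_comp_norm_sub hT (.inv₀ (by fun_prop) fun _ hx => (pow_pos hx n).ne')

lemma integral_inner_mul_inv_norm_sub_pow_three (hp : AffineIndependent ℝ p)
    (hT : r₀ ∉ triangle p) (h0 : ∀ i, 0 < R0 p r₀ i) (hd : ⟪d, wHat p⟫ = 0) :
    ∫ r in triangle p, ⟪d, r - r₀⟫ * (‖r - r₀‖ ^ 3)⁻¹ ∂μHE[2]
      = -∑ i, ⟪d, mHat p i⟫ * f2 p r₀ i := by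
  have hdiv := integral_mul_inner_sub hp hT (fun _ => hasDerivAt_inv_eq_mul)
    continuousOn_inv_pow_three.neg hd
  simp only [sideIntegral_inv_norm_sub hp (h0 _), neg_mul, integral_neg] at hdiv
  rw [← hdiv, neg_neg]
  simp only [mul_comm]

lemma integral_inner_mul_inv_norm_sub_pow_five (hp : AffineIndependent ℝ p)
    (hT : r₀ ∉ triangle p) (h0 : ∀ i, 0 < R0 p r₀ i) (hd : ⟪d, wHat p⟫ = 0) :
    -3 * ∫ r in triangle p, ⟪d, r - r₀⟫ * (‖r - r₀‖ ^ 5)⁻¹ ∂μHE[2]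
      = ∑ i, ⟪d, mHat p i⟫ * Rs p r₀ i := by
  have hdiv := integral_mul_inner_sub hp hT (fun _ => hasDerivAt_inv_pow_three)
    continuousOn_inv_pow_five hd
  simp only [sideIntegral_inv_norm_sub_pow_three hp (h0 _)] at hdiv
  rw [← hdiv, ← integral_const_mul]
  simp only [mul_comm, mul_left_comm]

lemma integral_inner_mul_inner_mul_inv_norm_sub_pow_five (hp : AffineIndependent ℝ p)
    (hT : r₀ ∉ triangle p) (h0 : ∀ i, 0 < R0 p r₀ i) {a : E3} (ha : ⟪a, wHat p⟫ = 0)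
    (hd : ⟪d, wHat p⟫ = 0) :
    ∫ r in triangle p, (⟪a, d⟫ * (‖r - r₀‖ ^ 3)⁻¹
        + -3 * (‖r - r₀‖ ^ 5)⁻¹ * (⟪a, r - r₀⟫ * ⟪d, r - r₀⟫)) ∂μHE[2]
      = ∑ i, ⟪d, mHat p i⟫
        * ⟪a, Rd p r₀ i • sHat p i + Rs p r₀ i • (t0 p r₀ i • mHat p i)⟫ := by
  simp only [← sideIntegral_inner_mul_inv_norm_sub_pow_three hp (h0 _) ha]
  exact integral_inner_mul_add_mul_inner_mul_inner hp hT (fun _ => hasDerivAt_inv_pow_three)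
    continuousOn_inv_pow_five a hd

lemma integral_inv_norm_sub_pow_three_sub (hp : AffineIndependent ℝ p) (hT : r₀ ∉ triangle p)
    (h0 : ∀ i, 0 < R0 p r₀ i) :
    ∫ r in triangle p, ((‖r - r₀‖ ^ 3)⁻¹ - 3 * w0 p r₀ ^ 2 * (‖r - r₀‖ ^ 5)⁻¹) ∂μHE[2]
      = -∑ i, t0 p r₀ i * Rs p r₀ i := by
  have hdiv := integral_two_mul_add_mul_norm_sq_sub hp hT h0 (fun _ => hasDerivAt_inv_pow_three)
    continuousOn_inv_pow_five
  simp only [sideIntegral_inv_norm_sub_pow_three hp (h0 _)] at hdiv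
  rw [← hdiv, ← integral_neg]
  refine setIntegral_congr_fun (isCompact_triangle p).measurableSet fun r hr => ?_
  have hpos : 0 < ‖r - r₀‖ := norm_sub_pos_iff.2 (ne_of_mem_of_not_mem hr hT)
  field_simp
  ring

lemma abs_w0_mul_integral_inv_norm_sub_pow_three (hp : AffineIndependent ℝ p)
    (hT : r₀ ∉ triangle p) (h0 : ∀ i, 0 < R0 p r₀ i) :
    |w0 p r₀| * ∫ r in triangle p, (‖r - r₀‖ ^ 3)⁻¹ ∂μHE[2] = beta p r₀ := by
  have hw := abs_nonneg (w0 p r₀)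
  have hψ : ContinuousOn (fun x : ℝ =>
      -(2 * x + |w0 p r₀|) * (x ^ 3 * (x + |w0 p r₀|) ^ 2)⁻¹) (Set.Ioi 0) := by
    refine .mul (by fun_prop) (.inv₀ (by fun_prop) fun x hx => ?_)
    have hx' : 0 < x := hx
    positivity
  have hdiv := integral_two_mul_add_mul_norm_sq_sub hp hT h0 (fun _ => hasDerivAt_inv_mul_add hw) hψ
  simp only [t0_mul_sideIntegral_inv_mul_add_abs_w0 hp (h0 _)] at hdiv
  rw [beta, ← hdiv, ← integral_const_mul]
  refine setIntegral_congr_fun (isCompact_triangle p).measurableSet fun r hr => ?_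
  have hpos : 0 < ‖r - r₀‖ := norm_sub_pos_iff.2 (ne_of_mem_of_not_mem hr hT)
  rw [← sq_abs (w0 p r₀)]
  field_simp
  ring

lemma w0_mul_integral_inv_norm_sub_pow_three (hp : AffineIndependent ℝ p)
    (hT : r₀ ∉ triangle p) (h0 : ∀ i, 0 < R0 p r₀ i) :
    w0 p r₀ * ∫ r in triangle p, (‖r - r₀‖ ^ 3)⁻¹ ∂μHE[2]
      = Real.sign (w0 p r₀) * beta p r₀ := by
  rw [← abs_w0_mul_integral_inv_norm_sub_pow_three hp hT h0, ← mul_assoc, real_sign_mul_abs]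

end SurfaceIntegrals

/-! ### The normal flux of the dipole field -/

section Flux

variable {p : Fin 3 → E3} {r₀ : E3}

/-- The component of `q` parallel to the plane of the triangle. -/
def tangential (p : Fin 3 → E3) (q : E3) : E3 := q - ⟪wHat p, q⟫ • wHat p

lemma inner_tangential_wHat (hp : AffineIndependent ℝ p) (q : E3) :
    ⟪tangential p q, wHat p⟫ = 0 := by
  rw [tangential, inner_sub_left, inner_smul_left, real_inner_self_eq_norm_sq, norm_wHat hp,
    real_inner_comm]
  simp only [conj_trivial, one_pow, mul_one, sub_self]

lemma inner_tangential_of_inner_wHat_eq_zero (q : E3) {d : E3} (hd : ⟪d, wHat p⟫ = 0) :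
    ⟪tangential p q, d⟫ = ⟪q, d⟫ := by
  rw [tangential, inner_sub_left, inner_smul_left, real_inner_comm d (wHat p), hd, mul_zero,
    sub_zero]

lemma coordA_eq_inner_sub (hp : AffineIndependent ℝ p) (r₀ : E3) (k : Fin 2) (r : E3) :
    coordA p r₀ k r = ⟪axis p k, r - r₀⟫ := by
  rw [coordA, ← sub_add_sub_cancel r (rho p r₀) r₀, rho_sub hp, inner_add_right, inner_smul_right,
    inner_axis_wHat hp, mul_zero, add_zero]

lemma normalFlux_eq (p : Fin 3 → E3) (q : E3) {r : E3} (hr : r ≠ r₀) :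
    normalFlux p q r₀ r = ⟪wHat p, q⟫ * (‖r - r₀‖ ^ 3)⁻¹
      - 3 * ⟪wHat p, r - r₀⟫ * ⟪q, r - r₀⟫ * (‖r - r₀‖ ^ 5)⁻¹ := by
  have hderiv : HasFDerivAt (dipole q r₀) _ r :=
    hasFDerivAt_inner_mul_comp_norm_sub q hr (hasDerivAt_inv_pow_three (norm_sub_pos_iff.2 hr))
  rw [normalFlux, real_inner_comm, gradient, InnerProductSpace.toDual_symm_apply, hderiv.fderiv]
  simp only [add_apply, smul_apply, innerSL_apply_apply, smul_eq_mul, real_inner_comm (wHat p)]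
  ring

lemma integrableOn_inner_mul_inv_norm_sub_pow (hT : r₀ ∉ triangle p) (a : E3) (n : ℕ) :
    IntegrableOn (fun r => ⟪a, r - r₀⟫ * (‖r - r₀‖ ^ n)⁻¹) (triangle p) μHE[2] :=
  integrableOn_triangle (.mul (by fun_prop) (continuousOn_inv_norm_sub_pow hT n))

lemma integrableOn_inner_mul_add_inner_mul_inner (hT : r₀ ∉ triangle p) (a d : E3) :
    IntegrableOn (fun r => ⟪a, d⟫ * (‖r - r₀‖ ^ 3)⁻¹
      + -3 * (‖r - r₀‖ ^ 5)⁻¹ * (⟪a, r - r₀⟫ * ⟪d, r - r₀⟫)) (triangle p) μHE[2] :=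
  integrableOn_triangle (((continuousOn_inv_norm_sub_pow hT 3).const_mul _).add
    (.mul ((continuousOn_inv_norm_sub_pow hT 5).const_mul _) (by fun_prop)))

lemma continuousOn_normalFlux (q : E3) (hT : r₀ ∉ triangle p) :
    ContinuousOn (normalFlux p q r₀) (triangle p) := by
  refine ContinuousOn.congr ?_ fun r hr => normalFlux_eq p q (ne_of_mem_of_not_mem hr hT)
  exact (continuousOn_const.mul (continuousOn_inv_norm_sub_pow hT 3)).sub
    (ContinuousOn.mul (by fun_prop) (continuousOn_inv_norm_sub_pow hT 5))

lemma integrableOn_mul_normalFlux (q : E3) (hT : r₀ ∉ triangle p) {h : E3 → ℝ}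
    (hh : ContinuousOn h (triangle p)) :
    IntegrableOn (fun r => h r * normalFlux p q r₀ r) (triangle p) μHE[2] :=
  integrableOn_triangle (hh.mul (continuousOn_normalFlux q hT))

lemma integrableOn_coordA_mul_normalFlux (q : E3) (hT : r₀ ∉ triangle p) (k : Fin 2) :
    IntegrableOn (fun r => coordA p r₀ k r * normalFlux p q r₀ r) (triangle p) μHE[2] :=
  integrableOn_mul_normalFlux q hT (by unfold coordA; fun_prop)

lemma normalFlux_eq_of_mem_triangle (hp : AffineIndependent ℝ p) (q : E3) (hT : r₀ ∉ triangle p)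
    {r : E3} (hr : r ∈ triangle p) :
    normalFlux p q r₀ r
      = ⟪wHat p, q⟫ * ((‖r - r₀‖ ^ 3)⁻¹ - 3 * w0 p r₀ ^ 2 * (‖r - r₀‖ ^ 5)⁻¹)
        + w0 p r₀ * (-3 * (⟪tangential p q, r - r₀⟫ * (‖r - r₀‖ ^ 5)⁻¹)) := by
  rw [normalFlux_eq p q (ne_of_mem_of_not_mem hr hT), tangential, inner_sub_left, inner_smul_left,
    inner_wHat_sub_of_mem_triangle hp r₀ hr, conj_trivial]
  ring

lemma I0_eq (hp : AffineIndependent ℝ p) (q : E3) (hT : r₀ ∉ triangle p)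
    (h0 : ∀ i, 0 < R0 p r₀ i) :
    I0 p q r₀ = ⟪q, ∑ i, Rs p r₀ i • (w0 p r₀ • mHat p i - t0 p r₀ i • wHat p)⟫ := by
  have hint3 : IntegrableOn
      (fun r => (‖r - r₀‖ ^ 3)⁻¹ - 3 * w0 p r₀ ^ 2 * (‖r - r₀‖ ^ 5)⁻¹) (triangle p) μHE[2] :=
    integrableOn_triangle ((continuousOn_inv_norm_sub_pow hT 3).sub
      ((continuousOn_inv_norm_sub_pow hT 5).const_mul _))
  have hint5 := integrableOn_inner_mul_inv_norm_sub_pow hT (tangential p q) 5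
  rw [I0, setIntegral_congr_fun (isCompact_triangle p).measurableSet fun r hr =>
      normalFlux_eq_of_mem_triangle hp q hT hr,
    integral_add (hint3.const_mul _) ((hint5.const_mul _).const_mul _), integral_const_mul,
    integral_const_mul, integral_const_mul, integral_inv_norm_sub_pow_three_sub hp hT h0,
    integral_inner_mul_inv_norm_sub_pow_five hp hT h0 (inner_tangential_wHat hp q)]
  simp only [inner_tangential_of_inner_wHat_eq_zero q (inner_mHat_wHat p _), inner_sum,
    inner_smul_right, inner_sub_right, Finset.mul_sum,
    real_inner_comm q (wHat p), ← Finset.sum_neg_distrib, ← Finset.sum_add_distrib]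
  refine Finset.sum_congr rfl fun i _ => ?_
  ring

lemma coordA_mul_normalFlux_eq_of_mem_triangle (hp : AffineIndependent ℝ p) (q : E3)
    (hT : r₀ ∉ triangle p) (k : Fin 2) {r : E3} (hr : r ∈ triangle p) :
    coordA p r₀ k r * normalFlux p q r₀ r
      = ⟪wHat p, q⟫ * (⟪axis p k, r - r₀⟫ * (‖r - r₀‖ ^ 3)⁻¹
          + w0 p r₀ ^ 2 * (-3 * (⟪axis p k, r - r₀⟫ * (‖r - r₀‖ ^ 5)⁻¹)))
        + w0 p r₀ * (⟪axis p k, tangential p q⟫ * (‖r - r₀‖ ^ 3)⁻¹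
          + -3 * (‖r - r₀‖ ^ 5)⁻¹ * (⟪axis p k, r - r₀⟫ * ⟪tangential p q, r - r₀⟫))
        - ⟪axis p k, q⟫ * (w0 p r₀ * (‖r - r₀‖ ^ 3)⁻¹) := by
  rw [normalFlux_eq_of_mem_triangle hp q hT hr, coordA_eq_inner_sub hp,
    real_inner_comm (tangential p q) (axis p k),
    inner_tangential_of_inner_wHat_eq_zero q (inner_axis_wHat hp k), real_inner_comm q (axis p k)]
  ring

lemma Ia_eq (hp : AffineIndependent ℝ p) (q : E3) (hT : r₀ ∉ triangle p)
    (h0 : ∀ i, 0 < R0 p r₀ i) (k : Fin 2) :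
    Ia p q r₀ k = ⟪q,
        w0 p r₀ • ∑ i, ⟪axis p k, Rd p r₀ i • sHat p i + Rs p r₀ i • (t0 p r₀ i • mHat p i)⟫
            • mHat p i
        - (Real.sign (w0 p r₀) * beta p r₀) • axis p k
        + ⟪axis p k, ∑ i, (Rs p r₀ i * w0 p r₀ ^ 2 - f2 p r₀ i) • mHat p i⟫ • wHat p⟫ := by
  have hk := inner_axis_wHat hp k
  have hint3 := integrableOn_inner_mul_inv_norm_sub_pow hT (axis p k) 3
  have hint5 := ((integrableOn_inner_mul_inv_norm_sub_pow hT (axis p k) 5).const_mul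
    (-3)).const_mul (w0 p r₀ ^ 2)
  have hint_hess := integrableOn_inner_mul_add_inner_mul_inner hT (axis p k) (tangential p q)
  have hint_w := (hint3.fun_add hint5).const_mul ⟪wHat p, q⟫
  have hint_t := hint_hess.const_mul (w0 p r₀)
  have hint_a := integrableOn_triangle (continuousOn_inv_norm_sub_pow hT 3)
  rw [Ia, setIntegral_congr_fun (isCompact_triangle p).measurableSet fun r hr =>
      coordA_mul_normalFlux_eq_of_mem_triangle hp q hT k hr,
    integral_sub (hint_w.fun_add hint_t) ((hint_a.const_mul _).const_mul _),
    integral_add hint_w hint_t, integral_const_mul, integral_const_mul, integral_const_mul,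
    integral_const_mul, integral_add hint3 hint5, integral_const_mul, integral_const_mul,
    integral_inner_mul_inv_norm_sub_pow_three hp hT h0 hk,
    integral_inner_mul_inv_norm_sub_pow_five hp hT h0 hk,
    integral_inner_mul_inner_mul_inv_norm_sub_pow_five hp hT h0 hk (inner_tangential_wHat hp q),
    w0_mul_integral_inv_norm_sub_pow_three hp hT h0]
  simp only [inner_tangential_of_inner_wHat_eq_zero q (inner_mHat_wHat p _), Fin.sum_univ_three,
    inner_add_right, inner_sub_right, inner_smul_right, real_inner_comm q (wHat p),
    real_inner_comm q (axis p k)]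
  ring

end Flux

/-! ### Linear basis functions -/

section BasisFunctions

variable {p : Fin 3 → E3} {r₀ : E3}

lemma sideLen_mul_v3 (hp : AffineIndependent ℝ p) : sideLen p 2 * v3 p = ‖areaVec p‖ := by
  have hv3 : v3 p = ⟪side p 1, mHat p 2⟫ := by
    rw [v3, ← inner_neg_right, vHat, neg_cross]
    rfl
  rw [hv3, sideLen_mul_inner_mHat,
    show cross (side p 1) (side p 2) = areaVec p from cross_side_side_add_one p 1,
    ← norm_areaVec_smul_wHat hp, inner_smul_left, real_inner_self_eq_norm_sq, norm_wHat hp,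
    norm_smul, norm_wHat hp]
  simp

lemma v3_ne_zero (hp : AffineIndependent ℝ p) : v3 p ≠ 0 :=
  right_ne_zero_of_mul ((sideLen_mul_v3 hp).trans_ne (norm_ne_zero_iff.2 (areaVec_ne_zero hp)))

lemma node_one_sub (p : Fin 3 → E3) : p 1 - p 0 = sideLen p 2 • uHat p :=
  (sideLen_smul_sHat p 2).symm

lemma node_two_sub (hp : AffineIndependent ℝ p) :
    p 2 - p 0 = u3 p • uHat p + v3 p • vHat p := by
  have hside : p 2 - p 0 = -side p 1 := (neg_sub (p 0) (p 2)).symm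
  have h := eq_frame_expansion hp (p 2 - p 0)
  rwa [hside, inner_neg_right, inner_neg_right, inner_neg_right, real_inner_comm (side p 1),
    real_inner_comm (side p 1), real_inner_comm (side p 1), inner_side_wHat hp, neg_zero, zero_smul,
    add_zero, ← u3, ← v3, ← hside] at h

lemma linear_uHat (hp : AffineIndependent ℝ p) (φ : E3 →ᵃ[ℝ] ℝ) :
    φ.linear (uHat p) = (φ (p 1) - φ (p 0)) * (sideLen p 2)⁻¹ := by
  have h := φ.linearMap_vsub (p 1) (p 0)
  rw [vsub_eq_sub, vsub_eq_sub, node_one_sub, map_smul, smul_eq_mul] at h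
  rw [eq_mul_inv_iff_mul_eq₀ (sideLen_pos hp 2).ne', ← h, mul_comm]

lemma linear_vHat (hp : AffineIndependent ℝ p) (φ : E3 →ᵃ[ℝ] ℝ) :
    φ.linear (vHat p) = (φ (p 2) - φ (p 0) - u3 p * φ.linear (uHat p)) * (v3 p)⁻¹ := by
  have h := φ.linearMap_vsub (p 2) (p 0)
  rw [vsub_eq_sub, vsub_eq_sub, node_two_sub hp, map_add, map_smul, map_smul, smul_eq_mul,
    smul_eq_mul] at h
  rw [eq_mul_inv_iff_mul_eq₀ (v3_ne_zero hp), ← h]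
  ring

lemma sub_node_eq_of_mem_triangle (hp : AffineIndependent ℝ p) (r₀ : E3) {r : E3}
    (hr : r ∈ triangle p) :
    r - p 0 = (u0 p r₀ + coordA p r₀ 0 r) • uHat p + (v0 p r₀ + coordA p r₀ 1 r) • vHat p := by
  have hu : u0 p r₀ + coordA p r₀ 0 r = ⟪uHat p, r - p 0⟫ := by
    rw [coordA_eq_inner_sub hp, u0, real_inner_comm, ← sub_add_sub_cancel' r₀ (p 0) r,
      inner_add_right]
    rfl
  have hv : v0 p r₀ + coordA p r₀ 1 r = ⟪vHat p, r - p 0⟫ := by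
    rw [coordA_eq_inner_sub hp, v0, real_inner_comm, ← sub_add_sub_cancel' r₀ (p 0) r,
      inner_add_right]
    rfl
  have hw : ⟪wHat p, r - p 0⟫ = 0 := by
    rw [inner_wHat_sub_of_mem_triangle hp (p 0) hr, w0, sub_self, inner_zero_left, neg_zero]
  rw [hu, hv]
  simpa only [hw, zero_smul, add_zero] using eq_frame_expansion hp (r - p 0)

lemma affineMap_eq_of_mem_triangle (hp : AffineIndependent ℝ p) (r₀ : E3) (φ : E3 →ᵃ[ℝ] ℝ)
    {r : E3} (hr : r ∈ triangle p) :
    φ r = φ (p 0) + (u0 p r₀ + coordA p r₀ 0 r) * φ.linear (uHat p)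
      + (v0 p r₀ + coordA p r₀ 1 r) * φ.linear (vHat p) := by
  have h := φ.linearMap_vsub r (p 0)
  rw [vsub_eq_sub, vsub_eq_sub, sub_node_eq_of_mem_triangle hp r₀ hr, map_add, map_smul, map_smul,
    smul_eq_mul, smul_eq_mul] at h
  linear_combination -h

lemma integral_affineMap_mul_normalFlux (hp : AffineIndependent ℝ p) (q : E3)
    (hT : r₀ ∉ triangle p) (φ : E3 →ᵃ[ℝ] ℝ) :
    ∫ r in triangle p, φ r * normalFlux p q r₀ r ∂μHE[2]
      = I0 p q r₀ * (φ (p 0) + φ.linear (uHat p) * u0 p r₀ + φ.linear (vHat p) * v0 p r₀)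
        + (φ.linear (uHat p) * Ia p q r₀ 0 + φ.linear (vHat p) * Ia p q r₀ 1) := by
  have hint0 := (integrableOn_triangle (continuousOn_normalFlux q hT)).const_mul
    (φ (p 0) + φ.linear (uHat p) * u0 p r₀ + φ.linear (vHat p) * v0 p r₀)
  have hint_u := (integrableOn_coordA_mul_normalFlux q hT 0).const_mul (φ.linear (uHat p))
  have hint_v := (integrableOn_coordA_mul_normalFlux q hT 1).const_mul (φ.linear (vHat p))
  rw [I0, Ia, Ia, mul_comm (∫ _ in _, _ ∂_), ← integral_const_mul, ← integral_const_mul,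
    ← integral_const_mul, ← integral_add hint_u hint_v,
    ← integral_add hint0 (hint_u.fun_add hint_v)]
  refine setIntegral_congr_fun (isCompact_triangle p).measurableSet fun r hr => ?_
  simp only [affineMap_eq_of_mem_triangle hp r₀ φ hr]
  ring

lemma basisMatrix_eq (hp : AffineIndependent ℝ p) {φ : Fin 3 → E3 →ᵃ[ℝ] ℝ}
    (hφ : ∀ i j, φ i (p j) = if i = j then 1 else 0) :
    basisMatrix p
      = Matrix.of fun i => ![φ i (p 0), (φ i).linear (uHat p), (φ i).linear (vHat p)] := by
  ext i j
  simp only [linear_vHat hp, linear_uHat hp, hφ]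
  fin_cases i <;> fin_cases j <;> simp [basisMatrix, neg_add_eq_sub]

lemma basisMatrixLin_eq (hp : AffineIndependent ℝ p) {φ : Fin 3 → E3 →ᵃ[ℝ] ℝ}
    (hφ : ∀ i j, φ i (p j) = if i = j then 1 else 0) :
    basisMatrixLin p = Matrix.of fun i => ![(φ i).linear (uHat p), (φ i).linear (vHat p)] := by
  ext i j
  simp only [linear_vHat hp, linear_uHat hp, hφ]
  fin_cases i <;> fin_cases j <;> simp [basisMatrixLin, neg_add_eq_sub]

lemma four_pi_smul_bs (hp : AffineIndependent ℝ p) (q : E3) (hT : r₀ ∉ triangle p)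
    {φ : Fin 3 → E3 →ᵃ[ℝ] ℝ} (hφ : ∀ i j, φ i (p j) = if i = j then 1 else 0) :
    (4 * Real.pi) • bs p q r₀ (fun i => φ i)
      = I0 p q r₀ • (basisMatrix p *ᵥ ![1, u0 p r₀, v0 p r₀])
        + basisMatrixLin p *ᵥ Ia p q r₀ := by
  ext i
  have hpi : 4 * Real.pi ≠ 0 := by positivity
  rw [Pi.add_apply, Pi.smul_apply, Pi.smul_apply, basisMatrix_eq hp hφ, basisMatrixLin_eq hp hφ,
    smul_eq_mul, smul_eq_mul, bs, ← mul_assoc, mul_one_div_cancel hpi,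
    one_mul, integral_affineMap_mul_normalFlux hp q hT]
  simp [Matrix.mulVec, dotProduct, Fin.sum_univ_three, add_assoc]

end BasisFunctions

end SurfaceElement

end

theorem mainTheorem2
    (p : Fin 3 → SurfaceElement.E3) (q r₀ : SurfaceElement.E3)
    (hp : AffineIndependent ℝ p)
    (hT : r₀ ∉ SurfaceElement.triangle p)
    (hline : ∀ i : Fin 3, r₀ ∉ line[ℝ, p (i - 1), p (i + 1)]) :
    -- the integrals converge
    IntegrableOn (SurfaceElement.normalFlux p q r₀) (SurfaceElement.triangle p) μHE[2] ∧
    (∀ k : Fin 2, IntegrableOn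
      (fun r => SurfaceElement.coordA p r₀ k r * SurfaceElement.normalFlux p q r₀ r)
      (SurfaceElement.triangle p) μHE[2]) ∧
    -- the closed form of the first moments
    (∀ k : Fin 2, SurfaceElement.Ia p q r₀ k =
      ⟪q,
        SurfaceElement.w0 p r₀ • ∑ i : Fin 3,
          ⟪SurfaceElement.axis p k,
            SurfaceElement.Rd p r₀ i • SurfaceElement.sHat p i
              + SurfaceElement.Rs p r₀ i • (SurfaceElement.t0 p r₀ i • SurfaceElement.mHat p i)⟫
            • SurfaceElement.mHat p i
        - (Real.sign (SurfaceElement.w0 p r₀) * SurfaceElement.beta p r₀)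
            • SurfaceElement.axis p k
        + ⟪SurfaceElement.axis p k,
            ∑ i : Fin 3, (SurfaceElement.Rs p r₀ i * SurfaceElement.w0 p r₀ ^ 2
              - SurfaceElement.f2 p r₀ i) • SurfaceElement.mHat p i⟫
            • SurfaceElement.wHat p⟫) ∧
    -- the closed form of `I₀`
    SurfaceElement.I0 p q r₀ =
      ⟪q, ∑ i : Fin 3, SurfaceElement.Rs p r₀ i •
        (SurfaceElement.w0 p r₀ • SurfaceElement.mHat p i
          - SurfaceElement.t0 p r₀ i • SurfaceElement.wHat p)⟫ ∧
    -- the surface element source vector of the linear basis functions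
    (∀ φ : Fin 3 → SurfaceElement.E3 →ᵃ[ℝ] ℝ,
      (∀ i j : Fin 3, φ i (p j) = if i = j then 1 else 0) →
      (∀ i : Fin 3, IntegrableOn (fun r => φ i r * SurfaceElement.normalFlux p q r₀ r)
        (SurfaceElement.triangle p) μHE[2]) ∧
      (4 * Real.pi) • SurfaceElement.bs p q r₀ (fun i => φ i) =
        SurfaceElement.I0 p q r₀ • (SurfaceElement.basisMatrix p
          *ᵥ ![1, SurfaceElement.u0 p r₀, SurfaceElement.v0 p r₀])
        + SurfaceElement.basisMatrixLin p *ᵥ SurfaceElement.Ia p q r₀) := by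
  have h0 (i : Fin 3) : 0 < SurfaceElement.R0 p r₀ i := SurfaceElement.R0_pos hp (hline i)
  have hint {h : SurfaceElement.E3 → ℝ} (hh : Continuous h) :=
    SurfaceElement.integrableOn_mul_normalFlux q hT hh.continuousOn
  exact ⟨SurfaceElement.integrableOn_triangle (SurfaceElement.continuousOn_normalFlux q hT),
    SurfaceElement.integrableOn_coordA_mul_normalFlux q hT,
    SurfaceElement.Ia_eq hp q hT h0, SurfaceElement.I0_eq hp q hT h0,
    fun φ hφ => ⟨fun i => hint (φ i).continuous_of_finiteDimensional,
      SurfaceElement.four_pi_smul_bs hp q hT hφ⟩⟩
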